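/- Let $n\in\{2,3\}$, let $\Omega\subset\mathbb{R}^n$ be a bounded domain with boundary $\Gamma$, and let $d_1>1$, $d_2>0$, $d_1>d_2$. Let $\Omega=\Omega_1\cup\Omega_2$, $\Omega_1=\Omega_{\rm IN}\cup\Omega_{\rm OUT}$, and let $\varepsilon,\sigma\in C^2(\Omega)$, with $\|\varepsilon\|_{C^2(\Omega)}<\infty$, satisfy $$\varepsilon(x)\in[1,d_1],\ \ \sigma(x)\in[0,d_2]\ \text{ for } x\in\Omega_{\rm IN},\qquad \varepsilon(x)=1,\ \ \sigma(x)=0\ \text{ for } x\in\Omega_2\cup\Omega_{\rm OUT}.$$ Let $K_h$ be a partition of $\Omega$ into finitely many closed simplices (a conforming simplicial mesh with union $\overline\Omega$), let $$W_h=\{w\in H^1(\Omega): w|_K\in P_1(K)\ \ \forall K\in K_h\},\qquad \mathbf W_{h}=[W_h]^3,\qquad \mathbf W_{h,0}=\{\mathbf v\in\mathbf W_h:\mathbf v=0\text{ on }\Gamma\}.$$ Write $(\cdot,\cdot)$ and $\|\cdot\|$ for the $L^2(\Omega)$ inner product and norm, $\|u\|_\omega^2=\int_\Omega\omega|u|^2\,dx$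 for a weight $\omega\ge 0$, and $\nabla\cdot F=\sum_{i=1}^n\partial_iF_i$. Let $$a(E,\mathbf v)=(\nabla E,\nabla\mathbf v)+(\nabla\cdot((\varepsilon-1)E),\nabla\cdot\mathbf v).$$ Let $T>0$, $j\in[L^2(\Omega\times(0,T))]^3$ and let $f_{0,h},f_{1,h}\in\mathbf W_h$ be discrete initial data. A solution of the semi-discrete problem is a function $E_h:[0,T]\to\mathbf W_{h,0}$ that is differentiable in time with absolutely continuous time derivative $\partial_tE_h$ (for instance $E_h\in C^2$ or $H^2$ in time) and satisfies, for almost every $t\in(0,T)$ and all $\mathbf v\in\mathbf W_{h,0}$, $$(\varepsilon\,\partial_{tt}E_h,\mathbf v)+(\sigma\,\partial_tE_h,\mathbf v)+a(E_h,\mathbf v)=-(j,\mathbf v),\qquad E_h(\cdot,0)=f_{0,h},\quad \partial_tE_h(\cdot,0)=f_{1,h}\ \text{ in }\Omega.$$ Suppose that a solution $E_h$ of the semi-discrete problem exists. Then it is unique, and for every $t^*\in(0,T)$ $$\|\partial_tE_h\|_\varepsilon^2(t^*)+\|E_h\|_\sigma^2(t^*)+\|\nabla E_h\|^2(t^*)+\|\nabla\cdot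 E_h\|_{\varepsilon-1}^2(t^*)\le C\Big[\|j\|_{\Omega\times(0,t^*)}^2+\|f_{1,h}\|_\varepsilon^2+\|\nabla f_{0,h}\|^2+\|f_{0,h}\|_\sigma^2+\|\nabla\cdot f_{0,h}\|_{\varepsilon-1}^2\Big],$$ where, for the given domain $\Omega$, the constant $C$ depends only on (upper bounds for) $\|\varepsilon\|_{C^2(\Omega)}$ and $\|\sigma\|_{L^\infty(\Omega)}$ and on $t^*$; in particular it does not depend on the mesh $K_h$, the data or the solution. -/

import Mathlib

open MeasureTheory Set
open scoped ENNReal NNReal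

noncomputable section

namespace StabMaxwell

/-- Points of the space `ℝⁿ`. -/
abbrev Pt (n : ℕ) := EuclideanSpace ℝ (Fin n)

/-- Values of the electric field, which has three components. -/
abbrev Vec := EuclideanSpace ℝ (Fin 3)

variable {n : ℕ}

/-! ### Differential operators

A finite element function is affine on every element, hence Lipschitz, and differentiable off the
skeleton of the mesh, which is a null set; its weak derivatives are its classical derivatives almost
everywhere.  So all first order differential operators below are the classical ones, and they are
only ever used under integrals over `Ω`. -/

/-- The partial derivative `∂ᵢ w`. -/
def pd (i : Fin n) (w : Pt n → ℝ) (x : Pt n) : ℝ :=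
  fderiv ℝ w x (EuclideanSpace.single i 1)

/-- The divergence `∑_{i ≤ n} ∂ᵢ Fᵢ` of a field with three components on `ℝⁿ`, `n ≤ 3`
(for `n = 2` nothing depends on the third coordinate, so `∂₃ F₃ = 0`). -/
def divergence (hn : n ≤ 3) (F : Pt n → Vec) (x : Pt n) : ℝ :=
  ∑ i : Fin n, pd i (fun y => F y (Fin.castLE hn i)) x

/-- The pointwise product `∇F : ∇G` of the Jacobians. -/
def gradDot (F G : Pt n → Vec) (x : Pt n) : ℝ :=
  ∑ k : Fin 3, ∑ i : Fin n, pd i (fun y => F y k) x * pd i (fun y => G y k) x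

/-! ### Inner products and norms -/

/-- The weighted inner product `(F, G)_ω = ∫_Ω ω F · G`. -/
def wInner (Ω : Set (Pt n)) (ω : Pt n → ℝ) (F G : Pt n → Vec) : ℝ :=
  ∫ x in Ω, ω x * inner ℝ (F x) (G x)

/-- The squared weighted norm `‖u‖²_ω = ∫_Ω ω |u|²` of a vector field or a scalar function. -/
def wNormSq {V : Type*} [NormedAddCommGroup V] (Ω : Set (Pt n)) (ω : Pt n → ℝ)
    (u : Pt n → V) : ℝ :=
  ∫ x in Ω, ω x * ‖u x‖ ^ 2

/-- `‖∇F‖² = ∫_Ω |∇F|²`. -/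
def gradNormSq (Ω : Set (Pt n)) (F : Pt n → Vec) : ℝ :=
  ∫ x in Ω, gradDot F F x

/-- `‖j‖²_{Ω_t} = ∫_{(0,t) × Ω} |j|²`. -/
def spaceTimeNormSq (Ω : Set (Pt n)) (t : ℝ) (j : ℝ → Pt n → Vec) : ℝ :=
  ∫ p in Ioo 0 t ×ˢ Ω, ‖j p.1 p.2‖ ^ 2

/-- The bilinear form `a(F, v) = (∇F, ∇v) + (∇ · ((ε - 1) F), ∇ · v)`. -/
def aForm (hn : n ≤ 3) (Ω : Set (Pt n)) (ε : Pt n → ℝ) (F v : Pt n → Vec) : ℝ :=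
  (∫ x in Ω, gradDot F v x) +
    ∫ x in Ω, divergence hn (fun y => (ε y - 1) • F y) x * divergence hn v x

/-- The norm of `C²(Ω)`: the supremum over `Ω` of `|f| + |Df| + |D²f|`. -/
def c2Norm (Ω : Set (Pt n)) (f : Pt n → ℝ) : ℝ≥0∞ :=
  ⨆ x ∈ Ω, ∑ k ∈ Finset.range 3, ‖iteratedFDeriv ℝ k f x‖ₑ

/-- The supremum norm over `Ω`. -/
def supNorm (Ω : Set (Pt n)) (f : Pt n → ℝ) : ℝ≥0∞ :=
  ⨆ x ∈ Ω, ‖f x‖ₑ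

/-! ### The coefficients -/

/-- The conditions on permittivity `ε` and conductivity `σ`: `Ω = Ω₁ ∪ Ω₂`, `Ω₁ = Ω_IN ∪ Ω_OUT`,
`ε ∈ [1, d₁]` and `σ ∈ [0, d₂]` on `Ω_IN`, `ε = 1` and `σ = 0` on `Ω₂ ∪ Ω_OUT`,
`ε, σ ∈ C²(Ω)`, `d₁ > 1`, `d₂ > 0`, `d₁ > d₂`. -/
structure CoeffCondition (Ω Ωin Ωout Ω₂ : Set (Pt n)) (d₁ d₂ : ℝ) (ε σ : Pt n → ℝ) : Prop where
  decomposition : Ω = (Ωin ∪ Ωout) ∪ Ω₂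
  one_lt : 1 < d₁
  pos : 0 < d₂
  lt : d₂ < d₁
  eps_C2 : ContDiffOn ℝ 2 ε Ω
  sigma_C2 : ContDiffOn ℝ 2 σ Ω
  eps_mem : ∀ x ∈ Ωin, ε x ∈ Icc 1 d₁
  sigma_mem : ∀ x ∈ Ωin, σ x ∈ Icc 0 d₂
  eps_eq : ∀ x ∈ Ω₂ ∪ Ωout, ε x = 1
  sigma_eq : ∀ x ∈ Ω₂ ∪ Ωout, σ x = 0

/-! ### Finite element spaces -/

/-- `w ∈ H¹(Ω)`: `w` and its weak first partial derivatives are in `L²(Ω)`. -/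
def MemH1 (Ω : Set (Pt n)) (w : Pt n → ℝ) : Prop :=
  MemLp w 2 (volume.restrict Ω) ∧
    ∀ i : Fin n, ∃ g : Pt n → ℝ, MemLp g 2 (volume.restrict Ω) ∧
      ∀ φ : Pt n → ℝ, ContDiff ℝ (⊤ : ℕ∞) φ → HasCompactSupport φ → tsupport φ ⊆ Ω →
        ∫ x in Ω, w x * pd i φ x = -∫ x in Ω, g x * φ x

/-- `Kh` is a partition of `Ω` into elements: a finite (conforming) simplicial complex with
underlying space `closure Ω` in which every face lies in an `n`-dimensional simplex. -/
structure IsMesh (Ω : Set (Pt n)) (Kh : Geometry.SimplicialComplex ℝ (Pt n)) : Prop where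
  finite : Kh.faces.Finite
  space_eq : Kh.space = closure Ω
  pure : ∀ s ∈ Kh.faces, ∃ u ∈ Kh.faces, s ⊆ u ∧ u.card = n + 1

/-- The scalar space `W_h(Ω) = {w ∈ H¹(Ω) : w|_K ∈ P₁(K) for all elements K}`; elements are closed
simplices, so members are continuous on `closure Ω`. -/
def MemWh (Ω : Set (Pt n)) (Kh : Geometry.SimplicialComplex ℝ (Pt n)) (w : Pt n → ℝ) : Prop :=
  MemH1 Ω w ∧ ∀ s ∈ Kh.faces, s.card = n + 1 →
    ∃ p : Pt n →ᵃ[ℝ] ℝ, EqOn w p (convexHull ℝ (s : Set (Pt n)))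

/-- The space `[W_h(Ω)]³`. -/
def MemWhVec (Ω : Set (Pt n)) (Kh : Geometry.SimplicialComplex ℝ (Pt n)) (F : Pt n → Vec) :
    Prop :=
  ∀ k : Fin 3, MemWh Ω Kh (fun x => F x k)

/-- The space of the `v ∈ [W_h(Ω)]³` with `v = 0` on the boundary of `Ω`. -/
def MemWhVec0 (Ω : Set (Pt n)) (Kh : Geometry.SimplicialComplex ℝ (Pt n)) (F : Pt n → Vec) :
    Prop :=
  MemWhVec Ω Kh F ∧ ∀ x ∈ frontier Ω, F x = 0

/-! ### The semi-discrete problem -/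

/-- The time derivative `∂ₜ E (t, x)` on `[0, T]` (one-sided at the end points). -/
def dt (T : ℝ) (E : ℝ → Pt n → Vec) (t : ℝ) (x : Pt n) : Vec :=
  derivWithin (fun s => E s x) (Icc 0 T) t

/-- `E` solves the semi-discrete problem on `[0, T]`: `E(t)` lies in the finite element space and
vanishes on the boundary, `∂ₜ E` exists on `[0, T]` and is absolutely continuous in time, so that
`∂ₜₜ E` exists for almost every `t` (this covers solutions that are `C²` or `H²` in time),
`(ε ∂ₜₜE, v) + (σ ∂ₜE, v) + a(E, v) = -(j, v)` for all test functions `v` for almost every `t`,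
and `E(0) = f₀`, `∂ₜE(0) = f₁` in `Ω`. -/
structure IsSemidiscreteSolution (hn : n ≤ 3) (Ω : Set (Pt n))
    (Kh : Geometry.SimplicialComplex ℝ (Pt n)) (ε σ : Pt n → ℝ) (T : ℝ)
    (j : ℝ → Pt n → Vec) (f₀ f₁ : Pt n → Vec) (E : ℝ → Pt n → Vec) : Prop where
  mem : ∀ t ∈ Icc 0 T, MemWhVec0 Ω Kh (E t)
  differentiable : ∀ x ∈ closure Ω, DifferentiableOn ℝ (fun t => E t x) (Icc 0 T)
  absolutelyContinuous :
    ∀ x ∈ closure Ω, AbsolutelyContinuousOnInterval (fun t => dt T E t x) 0 T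
  equation : ∀ᵐ t ∂(volume.restrict (Ioo 0 T)), ∀ v : Pt n → Vec, MemWhVec0 Ω Kh v →
    wInner Ω ε (dt T (dt T E) t) v + wInner Ω σ (dt T E t) v + aForm hn Ω ε (E t) v
      = -∫ x in Ω, inner ℝ (j t x) (v x)
  initial : ∀ x ∈ Ω, E 0 x = f₀ x
  initial_dt : ∀ x ∈ Ω, dt T E 0 x = f₁ x

/-- The squared energy norm
`|||E|||²(t) = ‖∂ₜE‖²_ε(t) + ‖E‖²_σ(t) + ‖∇E‖²(t) + ‖∇ · E‖²_{ε-1}(t)`. -/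
def energy (hn : n ≤ 3) (Ω : Set (Pt n)) (ε σ : Pt n → ℝ) (T : ℝ) (E : ℝ → Pt n → Vec)
    (t : ℝ) : ℝ :=
  wNormSq Ω ε (dt T E t) + wNormSq Ω σ (E t) + gradNormSq Ω (E t)
    + wNormSq Ω (fun x => ε x - 1) (divergence hn (E t))

end StabMaxwell

end

/-!
# Stability of the semi-discrete finite element scheme

Testing the equation with `∂ₜE` controls the time derivative of `‖∂ₜE‖²_ε + ‖∇E‖² + ‖∇ · E‖²_{ε-1}`
up to one term that the energy does not bound: `∇ · ((ε - 1) E) = (ε - 1) ∇ · E + ∇ε · E`, and the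
second summand contributes `B(E, ∂ₜE)` with `B(v, w) = (∇ε · v, ∇ · w)`, which contains `∇ · ∂ₜE`.
Since `B(E, ∂ₜE) = d/dt B(E, E) - B(∂ₜE, E)`, this term is harmless after `2 B(E, E)` has been added
to the energy; a multiple of `‖E‖²` is added as well to keep the sum coercive
(`modifiedEnergy`, `EnergyForms.le_modifiedEnergy`). Gronwall's inequality for absolutely continuous
functions (`le_exp_mul_of_ae_hasDerivAt_le`) then gives the estimate
`EnergyForms.modifiedEnergy_le_exp`. Only first derivatives of `ε` enter.

The added terms have to be bounded at time `0` by `‖∇f₀‖²`. This is Poincaré's inequality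
(`integral_sq_le_of_lipschitzWith`): a finite element function that vanishes on the boundary,
extended by zero, is Lipschitz on all of `ℝⁿ`, because it is Lipschitz on each member of a finite
closed cover (`lipschitzWith_of_finite_closed_cover`), and for Lipschitz functions `w² = w² ∂₁x₁` can
be integrated by parts.

To read the problem as a system of ordinary differential equations, a finite element function is
recovered linearly from its values at the vertices of the mesh (`exists_reconstruction`). The nodal
values of a solution are absolutely continuous together with their first derivatives, and the
reconstruction commutes with differentiation in time (`dt_eq_reconstruction`); in particular `∂ₜE`
belongs to the finite element space and is an admissible test function. Linearity of the integrals
in the reconstructed functions uses that almost every point is interior to an element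
(`ae_differentiableAt_memWh`).

Uniqueness follows from the same estimate, applied to the difference of two solutions, whose data
and right-hand side are zero.
-/

noncomputable section

namespace StabMaxwell

/-! ### Absolutely continuous functions and Gronwall's inequality -/

theorem absolutelyContinuousOnInterval_finsetSum {ι : Type*} (s : Finset ι) {f : ι → ℝ → ℝ}
    {a b : ℝ} (h : ∀ i ∈ s, AbsolutelyContinuousOnInterval (f i) a b) :
    AbsolutelyContinuousOnInterval (fun t => ∑ i ∈ s, f i t) a b := by
  classical
  induction s using Finset.induction_on with
  | empty =>
    simpa using (LipschitzWith.const (0 : ℝ)).lipschitzOnWith.absolutelyContinuousOnInterval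
  | insert i s hi ih =>
    simp_rw [Finset.sum_insert hi]
    exact (h i (by simp)).fun_add (ih fun k hk => h k (by simp [hk]))

/-- Gronwall's inequality for an absolutely continuous function whose derivative is controlled
almost everywhere. -/
theorem le_exp_mul_of_ae_hasDerivAt_le {Y g : ℝ → ℝ} {T c : ℝ} (hc : 0 ≤ c)
    (hY : AbsolutelyContinuousOnInterval Y 0 T) (hg : IntegrableOn g (Ioo 0 T))
    (hg0 : ∀ t, 0 ≤ g t)
    (h : ∀ᵐ t ∂(volume.restrict (Ioo 0 T)), ∃ y', HasDerivAt Y y' t ∧ y' ≤ c * Y t + g t)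
    {t : ℝ} (ht : t ∈ Icc 0 T) :
    Y t ≤ Real.exp (c * t) * (Y 0 + ∫ s in Ioo 0 t, g s) := by
  have hsub : uIcc 0 t ⊆ uIcc 0 T := by
    rw [uIcc_of_le ht.1, uIcc_of_le (ht.1.trans ht.2)]; exact Icc_subset_Icc_right ht.2
  -- Integrate the derivative of `exp (-c s) * Y s`, which is at most `g s`.
  have hexp : AbsolutelyContinuousOnInterval (fun s : ℝ => Real.exp (-c * s)) 0 t :=
    ContDiffOn.absolutelyContinuousOnInterval (by fun_prop)
  have hZ := hexp.fun_mul (hY.mono hsub)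
  have hint := hZ.integral_deriv_eq_sub
  have hle : ∫ s in (0 : ℝ)..t, deriv (fun s => Real.exp (-c * s) * Y s) s
      ≤ ∫ s in Ioo 0 t, g s := by
    rw [intervalIntegral.integral_of_le ht.1, integral_Ioc_eq_integral_Ioo]
    have hss : Ioo 0 t ⊆ Ioo 0 T := Ioo_subset_Ioo_right ht.2
    apply integral_mono_ae
    · have := hZ.intervalIntegrable_deriv
      rw [intervalIntegrable_iff_integrableOn_Ioo_of_le ht.1] at this
      exact this
    · exact hg.mono_set hss
    · filter_upwards [ae_restrict_of_ae_restrict_of_subset hss h, ae_restrict_mem measurableSet_Ioo]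
        with s ⟨y', hy', hle⟩ hs
      have h1 : HasDerivAt (fun s : ℝ => Real.exp (-c * s)) (Real.exp (-c * s) * (-c)) s := by
        simpa using ((hasDerivAt_id s).const_mul (-c)).exp
      rw [(h1.fun_mul hy').deriv]
      have h2 : Real.exp (-c * s) ≤ 1 := Real.exp_le_one_iff.2 (by nlinarith [hs.1])
      calc Real.exp (-c * s) * -c * Y s + Real.exp (-c * s) * y'
          ≤ Real.exp (-c * s) * -c * Y s + Real.exp (-c * s) * (c * Y s + g s) := by gcongr
        _ = Real.exp (-c * s) * g s := by ring
        _ ≤ 1 * g s := mul_le_mul_of_nonneg_right h2 (hg0 s)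
        _ = g s := one_mul _
  rw [hint] at hle
  simp only [mul_zero, Real.exp_zero, one_mul] at hle
  calc Y t = Real.exp (c * t) * (Real.exp (-c * t) * Y t) := by
        rw [← mul_assoc, ← Real.exp_add]; simp
    _ ≤ _ := by gcongr; linarith

/-! ### The energy estimate for a second order system of ordinary differential equations -/

section AbstractEnergy

variable {κ : Type*}

theorem bilin_eq_sum [Fintype κ] [DecidableEq κ] (β : (κ → ℝ) →ₗ[ℝ] (κ → ℝ) →ₗ[ℝ] ℝ) (u v : κ → ℝ) :
    β u v = ∑ k, ∑ l, β (Pi.single k 1) (Pi.single l 1) * (u k * v l) := by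
  conv_lhs => rw [pi_eq_sum_univ' u, pi_eq_sum_univ' v]
  simp only [map_sum, LinearMap.sum_apply, map_smul, LinearMap.smul_apply, smul_eq_mul,
    Finset.mul_sum]
  rw [Finset.sum_comm]
  exact Finset.sum_congr rfl fun k _ => Finset.sum_congr rfl fun l _ => by ring

theorem absolutelyContinuousOnInterval_bilin [Fintype κ] (β : (κ → ℝ) →ₗ[ℝ] (κ → ℝ) →ₗ[ℝ] ℝ)
    {p q : ℝ → κ → ℝ} {a b : ℝ}
    (hp : ∀ k, AbsolutelyContinuousOnInterval (fun t => p t k) a b)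
    (hq : ∀ k, AbsolutelyContinuousOnInterval (fun t => q t k) a b) :
    AbsolutelyContinuousOnInterval (fun t => β (p t) (q t)) a b := by
  classical
  rw [show (fun t => β (p t) (q t)) = _ from funext fun t => bilin_eq_sum β (p t) (q t)]
  exact absolutelyContinuousOnInterval_finsetSum _ fun k _ =>
    absolutelyContinuousOnInterval_finsetSum _ fun l _ => ((hp k).fun_mul (hq l)).const_mul _

theorem hasDerivAt_bilin [Fintype κ] (β : (κ → ℝ) →ₗ[ℝ] (κ → ℝ) →ₗ[ℝ] ℝ)
    {p q : ℝ → κ → ℝ} {p' q' : κ → ℝ} {t : ℝ}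
    (hp : HasDerivAt p p' t) (hq : HasDerivAt q q' t) :
    HasDerivAt (fun t => β (p t) (q t)) (β p' (q t) + β (p t) q') t := by
  classical
  rw [show (fun t => β (p t) (q t)) = _ from funext fun t => bilin_eq_sum β (p t) (q t),
    bilin_eq_sum β p', bilin_eq_sum β (p t)]
  simp only [← Finset.sum_add_distrib, ← mul_add]
  rw [hasDerivAt_pi] at hp hq
  exact HasDerivAt.fun_sum fun k _ => HasDerivAt.fun_sum fun l _ =>
    ((hp k).mul (hq l)).const_mul _

/-- The bilinear forms of the semi-discrete problem in coordinates and the inequalities between them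
that the energy estimate uses: `M` and `Mσ` are the mass matrices with weights `ε` and `σ`, `N` is
the one with weight `1`, `K` is the stiffness matrix, `D` is the weighted divergence form, and `B` is
the lower order form `(∇ε · v, ∇ · w)`. -/
structure EnergyForms (M Mσ K D B N : (κ → ℝ) →ₗ[ℝ] (κ → ℝ) →ₗ[ℝ] ℝ) (b : ℝ) : Prop where
  M_symm : ∀ v w, M v w = M w v
  K_symm : ∀ v w, K v w = K w v
  D_symm : ∀ v w, D v w = D w v
  N_symm : ∀ v w, N v w = N w v
  Mσ_nonneg : ∀ v, 0 ≤ Mσ v v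
  K_nonneg : ∀ v, 0 ≤ K v v
  D_nonneg : ∀ v, 0 ≤ D v v
  N_nonneg : ∀ v, 0 ≤ N v v
  N_le_M : ∀ v, N v v ≤ M v v
  b_nonneg : 0 ≤ b
  B_le : ∀ v w, 2 * |B v w| ≤ K w w / 2 + b * N v v

/-- The coercive functional to which Gronwall's inequality is applied. The lower order term
`2 B(p, p)` turns the contribution `B(p, ∂ₜp)`, which the energy does not control, into
`-B(∂ₜp, p)`; the multiple of `N` restores coercivity. -/
def modifiedEnergy (M K D B N : (κ → ℝ) →ₗ[ℝ] (κ → ℝ) →ₗ[ℝ] ℝ) (b : ℝ) (p q : κ → ℝ) : ℝ :=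
  M q q + K p p + D p p + 2 * B p p + (b + 1) * N p p

variable {M Mσ K D B N : (κ → ℝ) →ₗ[ℝ] (κ → ℝ) →ₗ[ℝ] ℝ} {b : ℝ}

theorem EnergyForms.le_modifiedEnergy (h : EnergyForms M Mσ K D B N b) (p q : κ → ℝ) :
    M q q + K p p / 2 + D p p + N p p ≤ modifiedEnergy M K D B N b p q := by
  have := h.B_le p p
  have := neg_abs_le (B p p)
  unfold modifiedEnergy
  linarith

theorem EnergyForms.modifiedEnergy_le (h : EnergyForms M Mσ K D B N b) (p q : κ → ℝ) :
    modifiedEnergy M K D B N b p q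
      ≤ M q q + 3 / 2 * K p p + D p p + (2 * b + 1) * N p p := by
  have := h.B_le p p
  have := le_abs_self (B p p)
  unfold modifiedEnergy
  linarith

theorem two_mul_bilin_le {N : (κ → ℝ) →ₗ[ℝ] (κ → ℝ) →ₗ[ℝ] ℝ} (hs : ∀ v w, N v w = N w v)
    (hn : ∀ v, 0 ≤ N v v) (v w : κ → ℝ) : 2 * N v w ≤ N v v + N w w := by
  have := hn (v - w)
  simp only [map_sub, LinearMap.sub_apply] at this
  linarith [hs v w]

/-- The energy estimate: `p` is a solution with first derivative `q` and second derivative `r`, the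
right-hand side is the functional `-ℓ t`, and `g` bounds its squared norm. -/
theorem EnergyForms.modifiedEnergy_le_exp [Fintype κ] (h : EnergyForms M Mσ K D B N b)
    {p q r : ℝ → κ → ℝ} {T : ℝ} {ℓ : ℝ → (κ → ℝ) → ℝ} {g : ℝ → ℝ}
    (hp : ∀ k, AbsolutelyContinuousOnInterval (fun t => p t k) 0 T)
    (hq : ∀ k, AbsolutelyContinuousOnInterval (fun t => q t k) 0 T)
    (hg : IntegrableOn g (Ioo 0 T)) (hg0 : ∀ t, 0 ≤ g t)
    (heq : ∀ᵐ t ∂(volume.restrict (Ioo 0 T)), HasDerivAt p (q t) t ∧ HasDerivAt q (r t) t ∧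
      ∀ v, M (r t) v + Mσ (q t) v + (K (p t) v + D (p t) v + B (p t) v) = -ℓ t v)
    (hℓ : ∀ᵐ t ∂(volume.restrict (Ioo 0 T)), ∀ v, 2 * |ℓ t v| ≤ g t + N v v)
    {t : ℝ} (ht : t ∈ Icc 0 T) :
    modifiedEnergy M K D B N b (p t) (q t) ≤ Real.exp ((2 * b + 2) * t) *
      (modifiedEnergy M K D B N b (p 0) (q 0) + ∫ s in Ioo 0 t, g s) := by
  have hb := h.b_nonneg
  refine le_exp_mul_of_ae_hasDerivAt_le
    (Y := fun t => modifiedEnergy M K D B N b (p t) (q t)) (by linarith) ?_ hg hg0 ?_ ht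
  · unfold modifiedEnergy
    exact ((((absolutelyContinuousOnInterval_bilin M hq hq).fun_add
      (absolutelyContinuousOnInterval_bilin K hp hp)).fun_add
      (absolutelyContinuousOnInterval_bilin D hp hp)).fun_add
      ((absolutelyContinuousOnInterval_bilin B hp hp).const_mul 2)).fun_add
      ((absolutelyContinuousOnInterval_bilin N hp hp).const_mul _)
  · filter_upwards [heq, hℓ] with t ⟨hpt, hqt, he⟩ hl
    refine ⟨_, ((((hasDerivAt_bilin M hqt hqt).fun_add (hasDerivAt_bilin K hpt hpt)).fun_add
      (hasDerivAt_bilin D hpt hpt)).fun_add ((hasDerivAt_bilin B hpt hpt).const_mul 2)).fun_add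
      ((hasDerivAt_bilin N hpt hpt).const_mul (b + 1)), ?_⟩
    -- Test with the time derivative of the solution.
    have h1 := he (q t)
    have h2 := hl (q t)
    have h3 := neg_abs_le (ℓ t (q t))
    have h4 := h.B_le (q t) (p t)
    have h5 := le_abs_self (B (q t) (p t))
    have h6 := two_mul_bilin_le h.N_symm h.N_nonneg (p t) (q t)
    have h7 := h.le_modifiedEnergy (p t) (q t)
    have h8 := h.Mσ_nonneg (q t)
    have h9 := h.N_le_M (q t)
    have h10 := mul_le_mul_of_nonneg_left h6 (by linarith : 0 ≤ b + 1)
    have h11 := mul_le_mul_of_nonneg_left h7 (by linarith : 0 ≤ 2 * b + 2)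
    have h12 := mul_le_mul_of_nonneg_left h9 (by linarith : 0 ≤ 2 * b + 2)
    have h13 := mul_nonneg hb (h.N_nonneg (p t))
    have h14 := mul_nonneg hb (h.K_nonneg (p t))
    have h15 := mul_nonneg hb (h.D_nonneg (p t))
    have h16 := h.N_nonneg (p t)
    have h17 := h.K_nonneg (p t)
    have h18 := h.D_nonneg (p t)
    rw [h.M_symm (q t) (r t), h.K_symm (q t) (p t), h.D_symm (q t) (p t), h.N_symm (q t) (p t)]
    linarith

end AbstractEnergy

/-! ### Lipschitz functions and Poincaré's inequality -/

open Filter Topology in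
/-- A function on a normed space that is Lipschitz on each member of a finite closed cover is
Lipschitz with the same constant. No convexity is needed: from each point of a segment one returns
to a member of the cover containing that point arbitrarily soon, which controls the lower slope. -/
theorem lipschitzWith_of_finite_closed_cover {E : Type*} [NormedAddCommGroup E] [NormedSpace ℝ E]
    {ι : Type*} [Finite ι] {C : ι → Set E} (hC : ∀ i, IsClosed (C i)) (hcov : ⋃ i, C i = univ)
    {u : E → ℝ} {L : ℝ≥0} (hu : ∀ i, LipschitzOnWith L u (C i)) : LipschitzWith L u := by
  have hcont : Continuous u :=
    (locallyFinite_of_finite C).continuous hcov hC fun i => (hu i).continuousOn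
  refine LipschitzWith.of_dist_le_mul fun x y => ?_
  set γ : ℝ → E := fun s => x + s • (y - x) with hγ
  have hγc : Continuous γ := by fun_prop
  set c : ℝ := L * dist x y
  have key : Icc (0 : ℝ) 1 ⊆ {s | dist (u x) (u (γ s)) ≤ c * s} := by
    refine IsClosed.Icc_subset_of_forall_exists_gt ?_ (by simp [hγ]) ?_
    · exact (isClosed_le (by fun_prop) (by fun_prop)).inter isClosed_Icc
    rintro s ⟨hs, -⟩ z hz
    -- Some member of the cover is met by `γ` at times arbitrarily close to `s` on the right.
    obtain ⟨i, hi⟩ : ∃ i, ∃ᶠ τ in 𝓝[>] s, γ τ ∈ C i := by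
      by_contra! hcon
      obtain ⟨τ, hτ⟩ := (eventually_all.2 hcon).exists
      have : γ τ ∈ ⋃ i, C i := hcov ▸ mem_univ _
      obtain ⟨i, hi⟩ := mem_iUnion.1 this
      exact hτ i hi
    have hsi : γ s ∈ C i :=
      ((hC i).preimage hγc).closure_subset
        (mem_closure_iff_frequently.2 (hi.filter_mono nhdsWithin_le_nhds))
    obtain ⟨τ, hτi, hτ⟩ := (hi.and_eventually (Ioc_mem_nhdsGT hz)).exists
    refine ⟨τ, ?_, hτ⟩
    have hd : dist (u (γ s)) (u (γ τ)) ≤ c * (τ - s) := by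
      refine ((hu i).dist_le_mul _ hsi _ hτi).trans_eq ?_
      have : γ s - γ τ = (τ - s) • (x - y) := by simp only [hγ]; module
      rw [dist_eq_norm, this, norm_smul, Real.norm_of_nonneg (by linarith [hτ.1]), ← dist_eq_norm]
      ring
    calc dist (u x) (u (γ τ)) ≤ dist (u x) (u (γ s)) + dist (u (γ s)) (u (γ τ)) :=
          dist_triangle _ _ _
      _ ≤ c * s + c * (τ - s) := add_le_add hs hd
      _ = c * τ := by ring
  simpa [hγ] using key (right_mem_Icc.2 zero_le_one)

theorem abs_pd_le_of_lipschitzWith {n : ℕ} {w : Pt n → ℝ} {L : ℝ≥0} (hw : LipschitzWith L w)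
    (i : Fin n) (x : Pt n) : |pd i w x| ≤ L := by
  have h1 := (fderiv ℝ w x).le_opNorm (EuclideanSpace.single i 1)
  rw [PiLp.norm_single, norm_one, mul_one] at h1
  exact h1.trans (norm_fderiv_le_of_lipschitz ℝ hw)

theorem measurable_pd {n : ℕ} (i : Fin n) (w : Pt n → ℝ) : Measurable (pd i w) :=
  measurable_fderiv_apply_const ℝ w _

/-- Poincaré's inequality for a Lipschitz function vanishing outside a bounded set, by integrating
`w² = w² ∂ᵢxᵢ` by parts. -/
theorem integral_sq_le_of_lipschitzWith {n : ℕ} {Ω : Set (Pt n)} (hΩ : MeasurableSet Ω)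
    {w : Pt n → ℝ} {L : ℝ≥0} {R : ℝ} (hw : LipschitzWith L w) (hR : ∀ x ∈ Ω, ‖x‖ ≤ R)
    (hw0 : ∀ x ∉ Ω, w x = 0) (i : Fin n) :
    ∫ x in Ω, w x ^ 2 ≤ 4 * R ^ 2 * ∫ x in Ω, pd i w x ^ 2 := by
  have hcw : Continuous w := hw.continuous
  have hsupp (x : Pt n) (hx : x ∉ Metric.closedBall 0 R) : w x = 0 :=
    hw0 x fun h => hx (mem_closedBall_zero_iff.2 (hR x h))
  have hcs : HasCompactSupport w := HasCompactSupport.intro (isCompact_closedBall 0 R) hsupp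
  have hcs2 : HasCompactSupport fun x => w x ^ 2 :=
    HasCompactSupport.intro (isCompact_closedBall 0 R) fun x hx => by simp [hsupp x hx]
  obtain ⟨B, hB⟩ := hcs.exists_bound_of_continuous hcw
  have hL2 : LipschitzWith (Real.toNNReal (2 * B * L)) fun x => w x ^ 2 := by
    refine LipschitzWith.of_dist_le_mul fun x y => ?_
    have h0 : 0 ≤ B := (norm_nonneg _).trans (hB 0)
    rw [Real.coe_toNNReal _ (by positivity), Real.dist_eq]
    have h1 := hw.dist_le_mul x y
    rw [Real.dist_eq] at h1
    have h2 : |w x + w y| ≤ 2 * B := (abs_add_le _ _).trans (by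
      have := hB x; have := hB y; simp only [Real.norm_eq_abs] at *; linarith)
    calc |w x ^ 2 - w y ^ 2| = |w x + w y| * |w x - w y| := by rw [← abs_mul]; ring_nf
      _ ≤ (2 * B) * (L * dist x y) := by gcongr
      _ = _ := by ring
  let ℓ : Pt n →L[ℝ] ℝ := EuclideanSpace.proj i
  -- Integrate by parts with the coordinate function `ℓ`, whose derivative along `e` is `1`.
  set e : Pt n := EuclideanSpace.single i 1 with he
  have hparts := LipschitzWith.integral_lineDeriv_mul_eq (μ := volume)
    ℓ.lipschitz hL2 hcs2 e
  have hone (x : Pt n) :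
      lineDeriv ℝ ℓ x e = 1 := by
    rw [(ContinuousLinearMap.differentiableAt _).lineDeriv_eq_fderiv, ContinuousLinearMap.fderiv]
    simp [he, ℓ]
  -- By Rademacher's theorem the chain rule for `w²` holds almost everywhere.
  have hline : ∀ᵐ x, lineDeriv ℝ (fun x => w x ^ 2) x (-e)
      * ℓ x
        = pd i w x * (-2 * w x * x i) := by
    filter_upwards [hw.ae_differentiableAt] with x hx
    have h1 : HasFDerivAt (fun x => w x ^ 2) _ x := hx.hasFDerivAt.pow 2
    rw [h1.differentiableAt.lineDeriv_eq_fderiv, h1.fderiv]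
    simp [pd, he, ℓ]
    ring
  have hIΩ : Integrable (Ω.indicator fun x => 2 * R ^ 2 * pd i w x ^ 2) := by
    rw [integrable_indicator_iff hΩ]
    have hfin : volume Ω < ∞ :=
      (Metric.isBounded_closedBall.subset
        fun x hx => mem_closedBall_zero_iff.2 (hR x hx)).measure_lt_top
    refine Measure.integrableOn_of_bounded (M := 2 * R ^ 2 * L ^ 2) hfin.ne
      (((measurable_pd i w).pow_const 2).const_mul _).aestronglyMeasurable ?_
    refine Filter.Eventually.of_forall fun x => ?_
    rw [Real.norm_of_nonneg (by positivity), ← sq_abs (pd i w x)]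
    gcongr
    exact abs_pd_le_of_lipschitzWith hw i x
  have hIw : Integrable fun x => w x ^ 2 := (hcw.pow 2).integrable_of_hasCompactSupport hcs2
  have hIl : Integrable fun x => pd i w x * (-2 * w x * x i) := by
    refine Integrable.bdd_mul (c := L) ?_ (measurable_pd i w).aestronglyMeasurable
      (Filter.Eventually.of_forall fun x => abs_pd_le_of_lipschitzWith hw i x)
    refine Continuous.integrable_of_hasCompactSupport (by fun_prop)
      (HasCompactSupport.intro (isCompact_closedBall 0 R) fun x hx => by simp [hsupp x hx])
  have hle : ∫ x, pd i w x * (-2 * w x * x i)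
      ≤ ∫ x, (w x ^ 2 / 2 + Ω.indicator (fun x => 2 * R ^ 2 * pd i w x ^ 2) x) := by
    refine integral_mono hIl ((hIw.div_const 2).add hIΩ) fun x => ?_
    by_cases hx : x ∈ Ω
    · have h1 : x i ^ 2 ≤ R ^ 2 := by
        rw [← sq_abs]
        gcongr
        exact (PiLp.norm_apply_le x i).trans (hR x hx)
      have h2 := mul_le_mul_of_nonneg_right h1 (sq_nonneg (pd i w x))
      simp only [hx, indicator_of_mem]
      nlinarith [sq_nonneg (w x + 2 * (x i * pd i w x))]
    · simp [hx, hw0 x hx]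
  rw [integral_add (hIw.div_const 2) hIΩ, integral_div, integral_indicator hΩ,
    integral_const_mul] at hle
  simp only [hone, one_mul] at hparts
  rw [integral_congr_ae hline] at hparts
  rw [setIntegral_eq_integral_of_forall_compl_eq_zero fun x hx => by simp [hw0 x hx]]
  linarith

/-! ### The finite element space -/

section FiniteElements

variable {n : ℕ} {Ω : Set (Pt n)} {Kh : Geometry.SimplicialComplex ℝ (Pt n)}

theorem memLp_two_of_hasCompactSupport {φ : Pt n → ℝ} (hφ : Continuous φ)
    (hc : HasCompactSupport φ) : MemLp φ 2 (volume.restrict Ω) :=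
  (hφ.memLp_of_hasCompactSupport hc).restrict Ω

theorem continuous_pd {i : Fin n} {φ : Pt n → ℝ} (hφ : ContDiff ℝ (⊤ : ℕ∞) φ) :
    Continuous (pd i φ) :=
  (hφ.continuous_fderiv (by simp)).clm_apply continuous_const

theorem hasCompactSupport_pd {i : Fin n} {φ : Pt n → ℝ} (hφ : HasCompactSupport φ) :
    HasCompactSupport (pd i φ) :=
  hφ.fderiv_apply ℝ _

theorem MemH1.add {u w : Pt n → ℝ} (hu : MemH1 Ω u) (hw : MemH1 Ω w) :
    MemH1 Ω (fun x => u x + w x) := by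
  refine ⟨hu.1.add hw.1, fun i => ?_⟩
  obtain ⟨g, hg, hgu⟩ := hu.2 i
  obtain ⟨g', hg', hgw⟩ := hw.2 i
  refine ⟨g + g', hg.add hg', fun φ h1 h2 h3 => ?_⟩
  have hφ := memLp_two_of_hasCompactSupport (Ω := Ω) h1.continuous h2
  have hpφ := memLp_two_of_hasCompactSupport (Ω := Ω) (continuous_pd (i := i) h1)
    (hasCompactSupport_pd h2)
  have e1 := integral_add (hu.1.integrable_mul hpφ) (hw.1.integrable_mul hpφ)
  have e2 := integral_add (hg.integrable_mul hφ) (hg'.integrable_mul hφ)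
  simp only [Pi.mul_apply] at e1 e2
  simp only [add_mul, Pi.add_apply]
  rw [e1, e2, hgu φ h1 h2 h3, hgw φ h1 h2 h3]
  ring

theorem MemH1.const_mul {w : Pt n → ℝ} (hw : MemH1 Ω w) (c : ℝ) :
    MemH1 Ω (fun x => c * w x) := by
  refine ⟨hw.1.const_mul c, fun i => ?_⟩
  obtain ⟨g, hg, hgw⟩ := hw.2 i
  refine ⟨fun x => c * g x, hg.const_mul c, fun φ h1 h2 h3 => ?_⟩
  simp only [mul_assoc]
  rw [integral_const_mul, integral_const_mul, hgw φ h1 h2 h3]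
  ring

theorem memH1_zero : MemH1 Ω (fun _ => (0 : ℝ)) :=
  ⟨MemLp.zero', fun _ => ⟨fun _ => 0, MemLp.zero', by simp⟩⟩

theorem MemH1.congr (hΩ : MeasurableSet Ω) {u w : Pt n → ℝ} (hu : MemH1 Ω u) (h : EqOn u w Ω) :
    MemH1 Ω w := by
  refine ⟨(memLp_congr_ae ((ae_restrict_mem hΩ).mono h)).1 hu.1, fun i => ?_⟩
  obtain ⟨g, hg, hgu⟩ := hu.2 i
  refine ⟨g, hg, fun φ h1 h2 h3 => ?_⟩
  rw [← hgu φ h1 h2 h3]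
  exact setIntegral_congr_fun hΩ fun x hx => by simp [h hx]

theorem MemWh.add {u w : Pt n → ℝ} (hu : MemWh Ω Kh u) (hw : MemWh Ω Kh w) :
    MemWh Ω Kh (fun x => u x + w x) := by
  refine ⟨hu.1.add hw.1, fun s hs hc => ?_⟩
  obtain ⟨p, hp⟩ := hu.2 s hs hc
  obtain ⟨q, hq⟩ := hw.2 s hs hc
  exact ⟨p + q, fun x hx => by simp [hp hx, hq hx]⟩

theorem MemWh.const_mul {w : Pt n → ℝ} (hw : MemWh Ω Kh w) (c : ℝ) :
    MemWh Ω Kh (fun x => c * w x) := by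
  refine ⟨hw.1.const_mul c, fun s hs hc => ?_⟩
  obtain ⟨q, hq⟩ := hw.2 s hs hc
  exact ⟨c • q, fun x hx => by simp [hq hx]⟩

theorem memWh_zero : MemWh Ω Kh (fun _ => (0 : ℝ)) :=
  ⟨memH1_zero, fun _ _ _ => ⟨0, fun x _ => by simp⟩⟩

theorem IsMesh.convexHull_subset (hK : IsMesh Ω Kh) {s : Finset (Pt n)} (hs : s ∈ Kh.faces) :
    convexHull ℝ (s : Set (Pt n)) ⊆ closure Ω :=
  hK.space_eq ▸ Kh.convexHull_subset_space hs

theorem IsMesh.exists_element (hK : IsMesh Ω Kh) {x : Pt n} (hx : x ∈ closure Ω) :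
    ∃ s ∈ Kh.faces, s.card = n + 1 ∧ x ∈ convexHull ℝ (s : Set (Pt n)) := by
  rw [← hK.space_eq, Kh.mem_space_iff] at hx
  obtain ⟨s, hs, hxs⟩ := hx
  obtain ⟨u, hu, hsu, hc⟩ := hK.pure s hs
  exact ⟨u, hu, hc, convexHull_mono (by exact_mod_cast hsu) hxs⟩

theorem MemWhVec0.congr (hΩ : IsOpen Ω) (hK : IsMesh Ω Kh) {F G : Pt n → Vec}
    (hF : MemWhVec0 Ω Kh F) (h : EqOn F G (closure Ω)) : MemWhVec0 Ω Kh G := by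
  refine ⟨fun k => ⟨(hF.1 k).1.congr hΩ.measurableSet fun x hx => ?_, fun s hs hc => ?_⟩,
    fun x hx => ?_⟩
  · simp [h (subset_closure hx)]
  · obtain ⟨p, hp⟩ := (hF.1 k).2 s hs hc
    exact ⟨p, fun x hx => by simp [← hp hx, h (hK.convexHull_subset hs hx)]⟩
  · rw [← h (frontier_subset_closure hx), hF.2 x hx]

variable (Ω Kh) in
/-- The space of the `v ∈ [W_h(Ω)]³` with `v = 0` on the boundary of `Ω`, each extended by zero. -/
def zeroExtSpace : Submodule ℝ (Pt n → Vec) where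
  carrier := {F | MemWhVec0 Ω Kh F ∧ ∀ x ∉ closure Ω, F x = 0}
  add_mem' := fun {F G} hF hG => ⟨⟨fun k => (hF.1.1 k).add (hG.1.1 k), fun x hx => by
    simp [hF.1.2 x hx, hG.1.2 x hx]⟩, fun x hx => by simp [hF.2 x hx, hG.2 x hx]⟩
  zero_mem' := ⟨⟨fun _ => memWh_zero, fun _ _ => rfl⟩, fun _ _ => rfl⟩
  smul_mem' := fun c F hF => ⟨⟨fun k => (hF.1.1 k).const_mul c, fun x hx => by
    simp [hF.1.2 x hx]⟩, fun x hx => by simp [hF.2 x hx]⟩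

theorem eq_zero_of_vertices {w : Pt n → ℝ} (hw : MemWh Ω Kh w) (hK : IsMesh Ω Kh)
    (h : ∀ s ∈ Kh.faces, ∀ x ∈ s, w x = 0) {x : Pt n} (hx : x ∈ closure Ω) : w x = 0 := by
  obtain ⟨s, hs, hc, hxs⟩ := hK.exists_element hx
  obtain ⟨p, hp⟩ := hw.2 s hs hc
  have hsub : convexHull ℝ (s : Set (Pt n)) ⊆ p ⁻¹' {0} := by
    refine convexHull_min (fun y hy => ?_) ((convex_singleton 0).affine_preimage p)
    rw [mem_preimage, ← hp (subset_convexHull ℝ _ hy)]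
    exact h s hs y hy
  rw [hp hxs]
  exact hsub hxs

variable (Kh) in
/-- The vertices of the mesh. -/
abbrev MeshVertex := {x : Pt n // ∃ s ∈ Kh.faces, x ∈ s}

theorem IsMesh.finite_meshVertex (hK : IsMesh Ω Kh) : Finite (MeshVertex Kh) := by
  refine Set.Finite.to_subtype (s := {x | ∃ s ∈ Kh.faces, x ∈ s}) ?_
  have : {x | ∃ s ∈ Kh.faces, x ∈ s} = ⋃ s ∈ Kh.faces, (s : Set (Pt n)) := by
    ext; simp
  rw [this]
  exact hK.finite.biUnion fun s _ => s.finite_toSet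

theorem IsMesh.mem_closure (hK : IsMesh Ω Kh) (v : MeshVertex Kh) : (v : Pt n) ∈ closure Ω := by
  obtain ⟨x, s, hs, hx⟩ := v
  exact hK.convexHull_subset hs (subset_convexHull ℝ _ hx)

/-- The finite element function with given nodal values: a linear map that recovers every member of
the finite element space from its values at the vertices. Nodal values that are not admissible
(because of the boundary condition) are projected to admissible ones. -/
theorem exists_reconstruction (hΩ : IsOpen Ω) (hK : IsMesh Ω Kh) :
    ∃ S : (MeshVertex Kh × Fin 3 → ℝ) →ₗ[ℝ] (Pt n → Vec),
      (∀ p, S p ∈ zeroExtSpace Ω Kh) ∧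
      ∀ F, MemWhVec0 Ω Kh F → EqOn (S fun a => F a.1 a.2) F (closure Ω) := by
  classical
  let ev : zeroExtSpace Ω Kh →ₗ[ℝ] (MeshVertex Kh × Fin 3 → ℝ) :=
    { toFun := fun F a => F.1 a.1 a.2
      map_add' := fun F G => by ext; simp
      map_smul' := fun c F => by ext; simp }
  have hinj : LinearMap.ker ev = ⊥ := by
    rw [LinearMap.ker_eq_bot']
    intro F hF
    ext x k
    by_cases hx : x ∈ closure Ω
    · refine eq_zero_of_vertices (F.2.1.1 k) hK (fun s hs y hy => ?_) hx
      exact congrFun hF (⟨y, s, hs, hy⟩, k)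
    · simp [F.2.2 x hx]
  obtain ⟨R, hR⟩ := ev.exists_leftInverse_of_injective hinj
  refine ⟨(zeroExtSpace Ω Kh).subtype ∘ₗ R, fun p => (R p).2, fun F hF x hx => ?_⟩
  have hmem : (closure Ω).indicator F ∈ zeroExtSpace Ω Kh :=
    ⟨hF.congr hΩ hK fun y hy => by simp [hy], fun y hy => by simp [hy]⟩
  have h1 : ev ⟨_, hmem⟩ = fun a => F a.1 a.2 := by
    ext a
    simp [ev, hK.mem_closure a.1]
  have h2 := LinearMap.congr_fun hR ⟨_, hmem⟩
  simp only [LinearMap.comp_apply, h1, LinearMap.id_apply] at h2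
  simp [h2, hx]

/-- A finite element function vanishing on the boundary, extended by zero, is Lipschitz on the
whole space: the elements and the complement of `Ω` form a finite closed cover. -/
theorem exists_lipschitzWith_of_mem_zeroExtSpace (hΩ : IsOpen Ω) (hK : IsMesh Ω Kh)
    {F : Pt n → Vec} (hF : F ∈ zeroExtSpace Ω Kh) (k : Fin 3) :
    ∃ L : ℝ≥0, LipschitzWith L fun x => F x k := by
  let el := {s : Finset (Pt n) // s ∈ Kh.faces ∧ s.card = n + 1}
  have : Finite el := (hK.finite.subset fun s hs => hs.1).to_subtype
  let C : Option el → Set (Pt n) := fun o => o.elim Ωᶜ fun s => convexHull ℝ (s.1 : Set (Pt n))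
  have hC (o) : IsClosed (C o) := by
    cases o with
    | none => exact hΩ.isClosed_compl
    | some s => exact (s.1.finite_toSet.isCompact_convexHull (𝕜 := ℝ)).isClosed
  have hcov : ⋃ o, C o = univ := by
    refine eq_univ_of_forall fun x => ?_
    by_cases hx : x ∈ Ω
    · obtain ⟨s, hs, hc, hxs⟩ := hK.exists_element (subset_closure hx)
      exact mem_iUnion.2 ⟨some ⟨s, hs, hc⟩, hxs⟩
    · exact mem_iUnion.2 ⟨none, hx⟩
  have hL (o) : ∃ L : ℝ≥0, LipschitzOnWith L (fun x => F x k) (C o) := by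
    cases o with
    | none =>
      refine ⟨0, fun x hx y hy => ?_⟩
      have h0 (z : Pt n) (hz : z ∈ Ωᶜ) : F z = 0 := by
        by_cases hz' : z ∈ closure Ω
        · exact hF.1.2 z (by rw [hΩ.frontier_eq]; exact ⟨hz', hz⟩)
        · exact hF.2 z hz'
      simp [h0 x hx, h0 y hy]
    | some s =>
      obtain ⟨p, hp⟩ := (hF.1.1 k).2 s.1 s.2.1 s.2.2
      refine ⟨‖LinearMap.toContinuousLinearMap p.linear‖₊, LipschitzOnWith.of_dist_le_mul
        fun x hx y hy => ?_⟩
      have h1 := (LinearMap.toContinuousLinearMap p.linear).le_opNorm (x - y)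
      have hx' : F x k = p x := hp hx
      have hy' : F y k = p y := hp hy
      rw [hx', hy', dist_eq_norm, dist_eq_norm, ← vsub_eq_sub (p x), ← AffineMap.linearMap_vsub]
      exact h1
  choose Lf hLf using hL
  obtain ⟨L, hL⟩ := Finite.exists_le Lf
  exact ⟨L, lipschitzWith_of_finite_closed_cover hC hcov fun o => (hLf o).weaken (hL o)⟩

theorem continuous_of_mem_zeroExtSpace (hΩ : IsOpen Ω) (hK : IsMesh Ω Kh)
    {F : Pt n → Vec} (hF : F ∈ zeroExtSpace Ω Kh) : Continuous F := by
  have h : Continuous fun x k => F x k := continuous_pi fun k =>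
    (exists_lipschitzWith_of_mem_zeroExtSpace hΩ hK hF k).choose_spec.continuous
  exact (PiLp.continuous_toLp 2 _).comp h

/-- Almost every point of `Ω` is interior to an element, and there all finite element functions are
differentiable. -/
theorem ae_differentiableAt_memWh (hΩ : MeasurableSet Ω) (hK : IsMesh Ω Kh) :
    ∀ᵐ x ∂(volume.restrict Ω), ∀ w, MemWh Ω Kh w → DifferentiableAt ℝ w x := by
  have hnull : ∀ᵐ x : Pt n, ∀ s ∈ Kh.faces, x ∉ frontier (convexHull ℝ (s : Set (Pt n))) := by
    rw [ae_ball_iff hK.finite.countable]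
    exact fun s _ => measure_eq_zero_iff_ae_notMem.1 ((convex_convexHull ℝ _).addHaar_frontier _)
  filter_upwards [ae_restrict_of_ae hnull, ae_restrict_mem hΩ] with x hx hxΩ w hw
  obtain ⟨s, hs, hc, hxs⟩ := hK.exists_element (subset_closure hxΩ)
  obtain ⟨p, hp⟩ := hw.2 s hs hc
  have hint : x ∈ interior (convexHull ℝ (s : Set (Pt n))) := by
    by_contra h
    exact hx s hs ⟨subset_closure hxs, h⟩
  have hpd : DifferentiableAt ℝ p x := by
    rw [p.decomp]
    exact (LinearMap.toContinuousLinearMap p.linear).differentiableAt.add_const _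
  exact hpd.congr_of_eventuallyEq (hp.eventuallyEq_of_mem (mem_interior_iff_mem_nhds.1 hint))

end FiniteElements

/-! ### The bilinear forms -/

section IntegralForms

variable {P X : Type*} [AddCommGroup P] [Module ℝ P] [MeasurableSpace X] {μ : Measure X}

/-- A function of two vectors that is bilinear, as a property. -/
structure IsBilin (f : P → P → ℝ) : Prop where
  add_left : ∀ u v w, f (u + v) w = f u w + f v w
  smul_left : ∀ (c : ℝ) v w, f (c • v) w = c * f v w
  add_right : ∀ u v w, f u (v + w) = f u v + f u w
  smul_right : ∀ (c : ℝ) v w, f v (c • w) = c * f v w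

/-- Integrating functions that are bilinear in two vectors at almost every point gives a bilinear
form. -/
theorem exists_integral_bilin {q : P → P → X → ℝ} (hint : ∀ v w, Integrable (q v w) μ)
    (hq : ∀ᵐ x ∂μ, IsBilin fun v w => q v w x) :
    ∃ β : P →ₗ[ℝ] P →ₗ[ℝ] ℝ, ∀ v w, β v w = ∫ x, q v w x ∂μ := by
  refine ⟨LinearMap.mk₂ ℝ (fun v w => ∫ x, q v w x ∂μ) (fun u v w => ?_) (fun c v w => ?_)
    (fun u v w => ?_) (fun c v w => ?_), fun v w => rfl⟩
  · rw [← integral_add (hint u w) (hint v w)]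
    exact integral_congr_ae (hq.mono fun x hx => hx.add_left u v w)
  · rw [smul_eq_mul, ← integral_const_mul]
    exact integral_congr_ae (hq.mono fun x hx => hx.smul_left c v w)
  · rw [← integral_add (hint u v) (hint u w)]
    exact integral_congr_ae (hq.mono fun x hx => hx.add_right u v w)
  · rw [smul_eq_mul, ← integral_const_mul]
    exact integral_congr_ae (hq.mono fun x hx => hx.smul_right c v w)

end IntegralForms

variable {n : ℕ} {Ω : Set (Pt n)} {Kh : Geometry.SimplicialComplex ℝ (Pt n)}

theorem inner_eq_sum (a b : Vec) : inner ℝ a b = ∑ k, a k * b k := by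
  simp [PiLp.inner_apply, mul_comm]

theorem sum_castLE_le (hn : n ≤ 3) {f : Fin 3 → ℝ} (hf : ∀ k, 0 ≤ f k) :
    ∑ i : Fin n, f (Fin.castLE hn i) ≤ ∑ k, f k := by
  have h := Finset.sum_map Finset.univ (Fin.castLEEmb hn) f
  simp only [Fin.coe_castLEEmb] at h
  rw [← h]
  exact Finset.sum_le_sum_of_subset_of_nonneg (Finset.subset_univ _) fun k _ _ => hf k

theorem gradDot_self_nonneg (F : Pt n → Vec) (x : Pt n) : 0 ≤ gradDot F F x :=
  Finset.sum_nonneg fun _ _ => Finset.sum_nonneg fun _ _ => mul_self_nonneg _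

theorem divergence_sq_le (hn : n ≤ 3) (F : Pt n → Vec) (x : Pt n) :
    divergence hn F x ^ 2 ≤ 3 * gradDot F F x := by
  have hn' : (n : ℝ) ≤ 3 := by exact_mod_cast hn
  have h0 : 0 ≤ ∑ i : Fin n, pd i (fun y => F y (Fin.castLE hn i)) x ^ 2 :=
    Finset.sum_nonneg fun _ _ => sq_nonneg _
  calc divergence hn F x ^ 2
      ≤ n * ∑ i : Fin n, pd i (fun y => F y (Fin.castLE hn i)) x ^ 2 := by
        simpa [divergence] using sq_sum_le_card_mul_sum_sq (s := (Finset.univ : Finset (Fin n)))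
          (f := fun i => pd i (fun y => F y (Fin.castLE hn i)) x)
    _ ≤ 3 * ∑ i : Fin n, pd i (fun y => F y (Fin.castLE hn i)) x ^ 2 := by gcongr
    _ ≤ 3 * ∑ i : Fin n, ∑ k : Fin 3, pd i (fun y => F y k) x ^ 2 := by
        gcongr with i
        exact Finset.single_le_sum (f := fun k => pd i (fun y => F y k) x ^ 2)
          (fun _ _ => sq_nonneg _) (Finset.mem_univ (Fin.castLE hn i))
    _ = 3 * gradDot F F x := by
        rw [Finset.sum_comm]
        simp only [gradDot, sq]

theorem pd_add {i : Fin n} {u w : Pt n → ℝ} {x : Pt n} (hu : DifferentiableAt ℝ u x)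
    (hw : DifferentiableAt ℝ w x) : pd i (fun y => u y + w y) x = pd i u x + pd i w x := by
  simp [pd, fderiv_fun_add hu hw]

theorem pd_const_mul {i : Fin n} {w : Pt n → ℝ} {x : Pt n} (c : ℝ)
    (hw : DifferentiableAt ℝ w x) : pd i (fun y => c * w y) x = c * pd i w x := by
  simp [pd, fderiv_const_mul hw]

theorem pd_mul {i : Fin n} {u w : Pt n → ℝ} {x : Pt n} (hu : DifferentiableAt ℝ u x)
    (hw : DifferentiableAt ℝ w x) :
    pd i (fun y => u y * w y) x = u x * pd i w x + pd i u x * w x := by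
  simp [pd, fderiv_fun_mul hu hw, mul_comm]

/-- The lower order part `∇ε · F` of `∇ · ((ε - 1) F)`. -/
def gradCoeffDot (hn : n ≤ 3) (ε : Pt n → ℝ) (F : Pt n → Vec) (x : Pt n) : ℝ :=
  ∑ i : Fin n, pd i ε x * F x (Fin.castLE hn i)

theorem divergence_sub_one_smul (hn : n ≤ 3) {ε : Pt n → ℝ} {F : Pt n → Vec} {x : Pt n}
    (hε : DifferentiableAt ℝ ε x) (hF : ∀ k, DifferentiableAt ℝ (fun y => F y k) x) :
    divergence hn (fun y => (ε y - 1) • F y) x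
      = (ε x - 1) * divergence hn F x + gradCoeffDot hn ε F x := by
  simp only [divergence, gradCoeffDot, Finset.mul_sum, ← Finset.sum_add_distrib]
  refine Finset.sum_congr rfl fun i _ => ?_
  have h := pd_mul (i := i) (hε.sub_const 1) (hF (Fin.castLE hn i))
  have h' : pd i (fun y => ε y - 1) x = pd i ε x := by simp [pd, fderiv_sub_const]
  rw [h'] at h
  simpa using h

theorem gradCoeffDot_sq_le (hn : n ≤ 3) {ε : Pt n → ℝ} {A : ℝ} {x : Pt n}
    (hε : ∀ i, |pd i ε x| ≤ A) (F : Pt n → Vec) :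
    gradCoeffDot hn ε F x ^ 2 ≤ 3 * A ^ 2 * inner ℝ (F x) (F x) := by
  have hn' : (n : ℝ) ≤ 3 := by exact_mod_cast hn
  have h1 : ∑ i : Fin n, pd i ε x ^ 2 ≤ 3 * A ^ 2 := by
    calc ∑ i : Fin n, pd i ε x ^ 2 ≤ ∑ _i : Fin n, A ^ 2 :=
          Finset.sum_le_sum fun i _ => sq_le_sq.2 ((hε i).trans (le_abs_self A))
      _ = n * A ^ 2 := by simp
      _ ≤ 3 * A ^ 2 := by gcongr
  have h2 : ∑ i : Fin n, F x (Fin.castLE hn i) ^ 2 ≤ inner ℝ (F x) (F x) := by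
    rw [inner_eq_sum]
    simp only [← sq]
    exact sum_castLE_le hn (f := fun k => F x k ^ 2) fun k => sq_nonneg _
  exact (Finset.sum_mul_sq_le_sq_mul_sq _ _ _).trans
    (mul_le_mul h1 h2 (Finset.sum_nonneg fun _ _ => sq_nonneg _) (by positivity))

/-- The conditions on the coefficients in the form in which the energy estimate uses them. -/
structure CoeffBounds (Ω : Set (Pt n)) (ε σ : Pt n → ℝ) (A S : ℝ) : Prop where
  eps_diff : ∀ x ∈ Ω, DifferentiableAt ℝ ε x
  sigma_cont : ContinuousOn σ Ω
  one_le_eps : ∀ x ∈ Ω, 1 ≤ ε x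
  eps_le : ∀ x ∈ Ω, ε x ≤ A
  pd_eps_le : ∀ x ∈ Ω, ∀ i, |pd i ε x| ≤ A
  sigma_nonneg : ∀ x ∈ Ω, 0 ≤ σ x
  sigma_le : ∀ x ∈ Ω, σ x ≤ S

theorem CoeffCondition.coeffBounds {Ωin Ωout Ω₂ : Set (Pt n)} {d₁ d₂ : ℝ} {ε σ : Pt n → ℝ}
    (h : CoeffCondition Ω Ωin Ωout Ω₂ d₁ d₂ ε σ) (hΩ : IsOpen Ω) {A S : ℝ≥0}
    (hA : c2Norm Ω ε ≤ (A : ℝ≥0∞)) (hS : supNorm Ω σ ≤ (S : ℝ≥0∞)) :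
    CoeffBounds Ω ε σ A S := by
  have hk (k : ℕ) (hk : k ∈ Finset.range 3) (x : Pt n) (hx : x ∈ Ω) :
      ‖iteratedFDeriv ℝ k ε x‖ ≤ A := by
    have h1 : ∑ k ∈ Finset.range 3, ‖iteratedFDeriv ℝ k ε x‖ₑ ≤ A := (iSup₂_le_iff.1 hA) x hx
    have h2 : ‖iteratedFDeriv ℝ k ε x‖ₑ ≤ (A : ℝ≥0∞) :=
      (Finset.single_le_sum (f := fun k => ‖iteratedFDeriv ℝ k ε x‖ₑ)
        (fun _ _ => zero_le) hk).trans h1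
    rw [enorm_le_coe] at h2
    exact_mod_cast h2
  have hcases (x) (hx : x ∈ Ω) : x ∈ Ωin ∨ x ∈ Ω₂ ∪ Ωout := by
    rw [h.decomposition] at hx
    rcases hx with (hx | hx) | hx
    exacts [.inl hx, .inr (.inr hx), .inr (.inl hx)]
  refine ⟨fun x hx => ?_, h.sigma_C2.continuousOn, fun x hx => ?_, fun x hx => ?_,
    fun x hx i => ?_, fun x hx => ?_, fun x hx => ?_⟩
  · exact (h.eps_C2.contDiffAt (hΩ.mem_nhds hx)).differentiableAt (by norm_num)
  · rcases hcases x hx with hx | hx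
    · exact (h.eps_mem x hx).1
    · exact (h.eps_eq x hx).ge
  · have := hk 0 (by simp) x hx
    rw [norm_iteratedFDeriv_zero] at this
    exact (le_abs_self _).trans this
  · have h1 := (fderiv ℝ ε x).le_opNorm (EuclideanSpace.single i 1)
    rw [PiLp.norm_single, norm_one, mul_one] at h1
    have h2 := hk 1 (by simp) x hx
    rw [norm_iteratedFDeriv_one] at h2
    exact h1.trans h2
  · rcases hcases x hx with hx | hx
    · exact (h.sigma_mem x hx).1
    · exact (h.sigma_eq x hx).ge
  · have h1 : ‖σ x‖ₑ ≤ (S : ℝ≥0∞) := (iSup₂_le_iff.1 hS) x hx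
    rw [enorm_le_coe] at h1
    exact (le_abs_self _).trans (by exact_mod_cast h1)

section Bounded

theorem memLp_top_apply (hΩ : IsOpen Ω) (hΩb : Bornology.IsBounded Ω) (hK : IsMesh Ω Kh)
    {F : Pt n → Vec} (hF : F ∈ zeroExtSpace Ω Kh) (k : Fin 3) :
    MemLp (fun x => F x k) ⊤ (volume.restrict Ω) := by
  obtain ⟨L, hL⟩ := exists_lipschitzWith_of_mem_zeroExtSpace hΩ hK hF k
  refine (hL.continuous.memLp_of_hasCompactSupport
    (HasCompactSupport.intro hΩb.isCompact_closure fun x hx => ?_)).restrict Ω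
  simp [hF.2 x hx]

theorem memLp_top_pd (hΩ : IsOpen Ω) (hK : IsMesh Ω Kh)
    {F : Pt n → Vec} (hF : F ∈ zeroExtSpace Ω Kh) (k : Fin 3) (i : Fin n) :
    MemLp (fun x => pd i (fun y => F y k) x) ⊤ (volume.restrict Ω) := by
  obtain ⟨L, hL⟩ := exists_lipschitzWith_of_mem_zeroExtSpace hΩ hK hF k
  exact memLp_top_of_bound (measurable_pd i _).aestronglyMeasurable L
    (Filter.Eventually.of_forall fun x => abs_pd_le_of_lipschitzWith hL i x)

theorem memLp_top_divergence (hn : n ≤ 3) (hΩ : IsOpen Ω) (hK : IsMesh Ω Kh)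
    {F : Pt n → Vec} (hF : F ∈ zeroExtSpace Ω Kh) :
    MemLp (divergence hn F) ⊤ (volume.restrict Ω) :=
  memLp_finsetSum Finset.univ fun i _ => memLp_top_pd hΩ hK hF _ i

theorem memLp_top_gradDot (hΩ : IsOpen Ω) (hK : IsMesh Ω Kh)
    {F G : Pt n → Vec} (hF : F ∈ zeroExtSpace Ω Kh) (hG : G ∈ zeroExtSpace Ω Kh) :
    MemLp (gradDot F G) ⊤ (volume.restrict Ω) :=
  memLp_finsetSum Finset.univ fun k _ => memLp_finsetSum Finset.univ fun i _ =>
    (memLp_top_pd hΩ hK hG k i).mul (memLp_top_pd hΩ hK hF k i)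

theorem memLp_top_inner (hΩ : IsOpen Ω) (hΩb : Bornology.IsBounded Ω) (hK : IsMesh Ω Kh)
    {F G : Pt n → Vec} (hF : F ∈ zeroExtSpace Ω Kh) (hG : G ∈ zeroExtSpace Ω Kh) :
    MemLp (fun x => (inner ℝ (F x) (G x) : ℝ)) ⊤ (volume.restrict Ω) := by
  simp only [inner_eq_sum]
  exact memLp_finsetSum Finset.univ fun k _ =>
    (memLp_top_apply hΩ hΩb hK hG k).mul (memLp_top_apply hΩ hΩb hK hF k)

theorem CoeffBounds.memLp_top_eps {ε σ : Pt n → ℝ} {A S : ℝ} (h : CoeffBounds Ω ε σ A S)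
    (hΩ : IsOpen Ω) : MemLp ε ⊤ (volume.restrict Ω) := by
  refine memLp_top_of_bound (ContinuousOn.aestronglyMeasurable
    (fun x hx => (h.eps_diff x hx).continuousAt.continuousWithinAt) hΩ.measurableSet) A ?_
  filter_upwards [ae_restrict_mem hΩ.measurableSet] with x hx
  rw [Real.norm_of_nonneg (zero_le_one.trans (h.one_le_eps x hx))]
  exact h.eps_le x hx

theorem CoeffBounds.memLp_top_sigma {ε σ : Pt n → ℝ} {A S : ℝ} (h : CoeffBounds Ω ε σ A S)
    (hΩ : IsOpen Ω) : MemLp σ ⊤ (volume.restrict Ω) := by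
  refine memLp_top_of_bound (h.sigma_cont.aestronglyMeasurable hΩ.measurableSet) S ?_
  filter_upwards [ae_restrict_mem hΩ.measurableSet] with x hx
  rw [Real.norm_of_nonneg (h.sigma_nonneg x hx)]
  exact h.sigma_le x hx

theorem CoeffBounds.memLp_top_gradCoeffDot {ε σ : Pt n → ℝ} {A S : ℝ}
    (h : CoeffBounds Ω ε σ A S) (hn : n ≤ 3) (hΩ : IsOpen Ω) (hΩb : Bornology.IsBounded Ω)
    (hK : IsMesh Ω Kh) {F : Pt n → Vec} (hF : F ∈ zeroExtSpace Ω Kh) :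
    MemLp (gradCoeffDot hn ε F) ⊤ (volume.restrict Ω) := by
  refine memLp_finsetSum Finset.univ fun i _ => (memLp_top_apply hΩ hΩb hK hF _).mul
    (memLp_top_of_bound (measurable_pd i ε).aestronglyMeasurable A ?_)
  filter_upwards [ae_restrict_mem hΩ.measurableSet] with x hx
  exact h.pd_eps_le x hx i

end Bounded

section Forms

variable {P : Type*} [AddCommGroup P] [Module ℝ P] (S : P →ₗ[ℝ] (Pt n → Vec)) {x : Pt n}

theorem isBilin_inner (x : Pt n) (c : ℝ) :
    IsBilin fun v w => c * inner ℝ (S v x) (S w x) where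
  add_left u v w := by simp [inner_add_left, mul_add]
  smul_left c v w := by simp [inner_smul_left]; ring
  add_right u v w := by simp [inner_add_right, mul_add]
  smul_right c v w := by simp [inner_smul_right]; ring

variable {S}

theorem pd_map_add (hS : ∀ v k, DifferentiableAt ℝ (fun y => S v y k) x) (v w : P) (i : Fin n)
    (k : Fin 3) : pd i (fun y => S (v + w) y k) x
      = pd i (fun y => S v y k) x + pd i (fun y => S w y k) x := by
  simpa using pd_add (i := i) (hS v k) (hS w k)

theorem pd_map_smul (hS : ∀ v k, DifferentiableAt ℝ (fun y => S v y k) x) (c : ℝ) (w : P)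
    (i : Fin n) (k : Fin 3) :
    pd i (fun y => S (c • w) y k) x = c * pd i (fun y => S w y k) x := by
  simpa using pd_const_mul (i := i) c (hS w k)

theorem isBilin_gradDot (hS : ∀ v k, DifferentiableAt ℝ (fun y => S v y k) x) :
    IsBilin fun v w => gradDot (S v) (S w) x where
  add_left u v w := by simp only [gradDot, pd_map_add hS, add_mul, Finset.sum_add_distrib]
  smul_left c v w := by simp only [gradDot, pd_map_smul hS, mul_assoc, Finset.mul_sum]
  add_right u v w := by simp only [gradDot, pd_map_add hS, mul_add, Finset.sum_add_distrib]
  smul_right c v w := by simp only [gradDot, pd_map_smul hS, mul_left_comm, Finset.mul_sum]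

theorem divergence_map_add (hn : n ≤ 3) (hS : ∀ v k, DifferentiableAt ℝ (fun y => S v y k) x)
    (v w : P) : divergence hn (S (v + w)) x = divergence hn (S v) x + divergence hn (S w) x := by
  simp only [divergence, pd_map_add hS, Finset.sum_add_distrib]

theorem divergence_map_smul (hn : n ≤ 3) (hS : ∀ v k, DifferentiableAt ℝ (fun y => S v y k) x)
    (c : ℝ) (w : P) : divergence hn (S (c • w)) x = c * divergence hn (S w) x := by
  simp only [divergence, pd_map_smul hS, Finset.mul_sum]

theorem isBilin_divergence (hn : n ≤ 3) (hS : ∀ v k, DifferentiableAt ℝ (fun y => S v y k) x)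
    (c : ℝ) : IsBilin fun v w => c * (divergence hn (S v) x * divergence hn (S w) x) where
  add_left u v w := by rw [divergence_map_add hn hS]; ring
  smul_left c v w := by rw [divergence_map_smul hn hS]; ring
  add_right u v w := by rw [divergence_map_add hn hS]; ring
  smul_right c v w := by rw [divergence_map_smul hn hS]; ring

theorem isBilin_gradCoeffDot (hn : n ≤ 3) (ε : Pt n → ℝ)
    (hS : ∀ v k, DifferentiableAt ℝ (fun y => S v y k) x) :
    IsBilin fun v w => gradCoeffDot hn ε (S v) x * divergence hn (S w) x where
  add_left u v w := by
    simp only [gradCoeffDot, map_add, Pi.add_apply, PiLp.add_apply, mul_add, add_mul,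
      Finset.sum_add_distrib]
  smul_left c v w := by
    simp only [gradCoeffDot, map_smul, Pi.smul_apply, PiLp.smul_apply, smul_eq_mul,
      mul_left_comm _ c, ← Finset.mul_sum, mul_assoc]
  add_right u v w := by rw [divergence_map_add hn hS]; ring
  smul_right c v w := by rw [divergence_map_smul hn hS]; ring

end Forms

/-- The integrals of the semi-discrete problem, as functions of the nodal values, are bilinear forms
that satisfy the inequalities required by the energy estimate. The factor `18 = 6 · 3` comes from
`2 |x y| ≤ 6 x² + y² / 6` with `|∇ε · v|² ≤ 3 A² |v|²` and `(∇ · w)² ≤ 3 |∇w|²`. -/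
theorem exists_energyForms (hn : n ≤ 3) (hΩ : IsOpen Ω) (hΩb : Bornology.IsBounded Ω)
    (hK : IsMesh Ω Kh) {ε σ : Pt n → ℝ} {A S' : ℝ} (h : CoeffBounds Ω ε σ A S') {κ : Type*}
    {S : (κ → ℝ) →ₗ[ℝ] (Pt n → Vec)} (hS : ∀ p, S p ∈ zeroExtSpace Ω Kh) :
    ∃ M Mσ K D B N : (κ → ℝ) →ₗ[ℝ] (κ → ℝ) →ₗ[ℝ] ℝ,
      EnergyForms M Mσ K D B N (18 * A ^ 2) ∧
      (∀ v w, M v w = wInner Ω ε (S v) (S w)) ∧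
      (∀ v w, Mσ v w = wInner Ω σ (S v) (S w)) ∧
      (∀ v w, K v w + D v w + B v w = aForm hn Ω ε (S v) (S w)) ∧
      (∀ v, K v v = gradNormSq Ω (S v)) ∧
      (∀ v, D v v = wNormSq Ω (fun x => ε x - 1) (divergence hn (S v))) ∧
      (∀ v w, N v w = wInner Ω 1 (S v) (S w)) ∧
      (∀ v, Mσ v v ≤ S' * N v v) := by
  have hfin : IsFiniteMeasure (volume.restrict Ω) := isFiniteMeasure_restrict.2 hΩb.measure_lt_top.ne
  have hint {f : Pt n → ℝ} (hf : MemLp f ⊤ (volume.restrict Ω)) :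
      Integrable f (volume.restrict Ω) := hf.integrable le_top
  have hdiff : ∀ᵐ x ∂(volume.restrict Ω), ∀ v k, DifferentiableAt ℝ (fun y => S v y k) x := by
    filter_upwards [ae_differentiableAt_memWh hΩ.measurableSet hK] with x hx v k
    exact hx _ ((hS v).1.1 k)
  have hmem : ∀ᵐ x ∂(volume.restrict Ω), x ∈ Ω := ae_restrict_mem hΩ.measurableSet
  have hinner v w := memLp_top_inner hΩ hΩb hK (hS v) (hS w)
  have hdiv v := memLp_top_divergence hn hΩ hK (hS v)
  have hgc v := h.memLp_top_gradCoeffDot hn hΩ hΩb hK (hS v)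
  have hε := h.memLp_top_eps hΩ
  have hε1 : MemLp (fun x => ε x - 1) ⊤ (volume.restrict Ω) := hε.sub (memLp_const 1)
  have hmul {f g : Pt n → ℝ} (hf : MemLp f ⊤ (volume.restrict Ω))
      (hg : MemLp g ⊤ (volume.restrict Ω)) :
      MemLp (fun x => f x * g x) ⊤ (volume.restrict Ω) := hg.mul hf
  have hIM v w := hint (hmul hε (hinner v w))
  have hIσ v w := hint (hmul (h.memLp_top_sigma hΩ) (hinner v w))
  have hIK v w := hint (memLp_top_gradDot hΩ hK (hS v) (hS w))
  have hID v w := hint (hmul hε1 (hmul (hdiv v) (hdiv w)))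
  have hIB v w := hint (hmul (hgc v) (hdiv w))
  have hIN v w := hint ((hinner v w).const_mul 1)
  obtain ⟨M, hM⟩ := exists_integral_bilin hIM (.of_forall fun x => isBilin_inner S x (ε x))
  obtain ⟨Mσ, hMσ⟩ := exists_integral_bilin hIσ (.of_forall fun x => isBilin_inner S x (σ x))
  obtain ⟨N, hN⟩ := exists_integral_bilin hIN (.of_forall fun x => isBilin_inner S x 1)
  obtain ⟨K, hK'⟩ := exists_integral_bilin hIK (hdiff.mono fun x hx => isBilin_gradDot hx)
  obtain ⟨D, hD⟩ := exists_integral_bilin hID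
    (hdiff.mono fun x hx => isBilin_divergence hn hx (ε x - 1))
  obtain ⟨B, hB⟩ := exists_integral_bilin hIB
    (hdiff.mono fun x hx => isBilin_gradCoeffDot hn ε hx)
  refine ⟨M, Mσ, K, D, B, N, ?_, hM, hMσ, fun v w => ?_, fun v => hK' v v, fun v => ?_, hN, fun v => ?_⟩
  · refine ⟨fun v w => ?_, fun v w => ?_, fun v w => ?_, fun v w => ?_, fun v => ?_, fun v => ?_,
      fun v => ?_, fun v => ?_, fun v => ?_, by positivity, fun v w => ?_⟩
    · rw [hM, hM]
      simp only [real_inner_comm]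
    · rw [hK', hK']
      simp only [gradDot, mul_comm]
    · rw [hD, hD]
      simp only [mul_comm (divergence hn (S v) _)]
    · rw [hN, hN]
      simp only [real_inner_comm]
    · rw [hMσ]
      exact integral_nonneg_of_ae (hmem.mono fun x hx =>
        mul_nonneg (h.sigma_nonneg x hx) real_inner_self_nonneg)
    · rw [hK']
      exact integral_nonneg fun x => gradDot_self_nonneg _ x
    · rw [hD]
      exact integral_nonneg_of_ae (hmem.mono fun x hx =>
        mul_nonneg (sub_nonneg.2 (h.one_le_eps x hx)) (mul_self_nonneg _))
    · rw [hN]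
      exact integral_nonneg fun x => mul_nonneg zero_le_one real_inner_self_nonneg
    · rw [hN, hM]
      exact integral_mono_ae (hIN v v) (hIM v v) (hmem.mono fun x hx =>
        mul_le_mul_of_nonneg_right (h.one_le_eps x hx) real_inner_self_nonneg)
    · rw [hB, hK', hN]
      calc 2 * |∫ x in Ω, gradCoeffDot hn ε (S v) x * divergence hn (S w) x|
          ≤ 2 * ∫ x in Ω, |gradCoeffDot hn ε (S v) x * divergence hn (S w) x| := by
            gcongr
            exact abs_integral_le_integral_abs
        _ = ∫ x in Ω, 2 * |gradCoeffDot hn ε (S v) x * divergence hn (S w) x| :=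
            (integral_const_mul _ _).symm
        _ ≤ ∫ x in Ω, (gradDot (S w) (S w) x / 2
              + 18 * A ^ 2 * (1 * inner ℝ (S v x) (S v x))) := by
            refine integral_mono_ae ((hIB v w).abs.const_mul 2)
              (((hIK w w).div_const 2).add ((hIN v v).const_mul _)) ?_
            filter_upwards [hmem] with x hx
            have h1 := gradCoeffDot_sq_le hn (h.pd_eps_le x hx) (S v)
            have h2 := divergence_sq_le hn (S w) x
            have h3 := sq_nonneg
              (6 * |gradCoeffDot hn ε (S v) x| - |divergence hn (S w) x|)
            rw [← sq_abs] at h1 h2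
            rw [abs_mul]
            nlinarith
        _ = _ := by
            rw [integral_add ((hIK w w).div_const 2) ((hIN v v).const_mul _), integral_div,
              integral_const_mul]
  · rw [hK', hD, hB, add_assoc, aForm, ← integral_add (hID v w) (hIB v w)]
    congr 1
    refine integral_congr_ae ?_
    filter_upwards [hdiff, hmem] with x hx hxΩ
    rw [divergence_sub_one_smul hn (h.eps_diff x hxΩ) (hx v)]
    ring
  · rw [hD]
    simp only [wNormSq, Real.norm_eq_abs, sq, abs_mul_abs_self]
  · rw [hMσ, hN, ← integral_const_mul]
    refine integral_mono_ae (hIσ v v) ((hIN v v).const_mul S') (hmem.mono fun x hx => ?_)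
    simp only [one_mul]
    exact mul_le_mul_of_nonneg_right (h.sigma_le x hx) real_inner_self_nonneg

/-- Poincaré's inequality for the finite element space. -/
theorem wInner_one_le (hn₂ : 2 ≤ n) (hΩ : IsOpen Ω) (hΩb : Bornology.IsBounded Ω)
    (hK : IsMesh Ω Kh) {R : ℝ} (hR : ∀ x ∈ Ω, ‖x‖ ≤ R) {F : Pt n → Vec}
    (hF : F ∈ zeroExtSpace Ω Kh) :
    wInner Ω 1 F F ≤ 4 * R ^ 2 * gradNormSq Ω F := by
  have hfin : IsFiniteMeasure (volume.restrict Ω) := isFiniteMeasure_restrict.2 hΩb.measure_lt_top.ne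
  let i₀ : Fin n := ⟨0, by omega⟩
  have hi1 k : Integrable (fun x => F x k ^ 2) (volume.restrict Ω) := by
    simp only [sq]
    exact ((memLp_top_apply hΩ hΩb hK hF k).mul (memLp_top_apply hΩ hΩb hK hF k)).integrable le_top
  have hi2 k : Integrable (fun x => pd i₀ (fun y => F y k) x ^ 2) (volume.restrict Ω) := by
    simp only [sq]
    exact ((memLp_top_pd hΩ hK hF k i₀).mul (memLp_top_pd hΩ hK hF k i₀)).integrable le_top
  have h0 (x) (hx : x ∉ Ω) : F x = 0 := by
    by_cases hx' : x ∈ closure Ω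
    · exact hF.1.2 x (by rw [hΩ.frontier_eq]; exact ⟨hx', hx⟩)
    · exact hF.2 x hx'
  calc wInner Ω 1 F F = ∑ k, ∫ x in Ω, F x k ^ 2 := by
        rw [← integral_finsetSum _ fun k _ => hi1 k]
        simp only [wInner, inner_eq_sum, sq, Pi.one_apply, one_mul]
    _ ≤ ∑ k : Fin 3, 4 * R ^ 2 * ∫ x in Ω, pd i₀ (fun y => F y k) x ^ 2 := by
        refine Finset.sum_le_sum fun k _ => ?_
        obtain ⟨L, hL⟩ := exists_lipschitzWith_of_mem_zeroExtSpace hΩ hK hF k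
        exact integral_sq_le_of_lipschitzWith hΩ.measurableSet hL hR
          (fun x hx => by simp [h0 x hx]) i₀
    _ = 4 * R ^ 2 * ∫ x in Ω, ∑ k : Fin 3, pd i₀ (fun y => F y k) x ^ 2 := by
        rw [← Finset.mul_sum, integral_finsetSum _ fun k _ => hi2 k]
    _ ≤ 4 * R ^ 2 * gradNormSq Ω F := by
        refine mul_le_mul_of_nonneg_left ?_ (by positivity)
        refine integral_mono (integrable_finsetSum _ fun k _ => hi2 k)
          ((memLp_top_gradDot hΩ hK hF hF).integrable le_top) fun x => ?_
        refine Finset.sum_le_sum fun k _ => ?_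
        rw [sq]
        exact Finset.single_le_sum
          (f := fun i => pd i (fun y => F y k) x * pd i (fun y => F y k) x)
          (fun _ _ => mul_self_nonneg _) (Finset.mem_univ i₀)

/-- The `L²` norm is definite on the finite element space. -/
theorem eq_zero_of_wInner_one (hΩ : IsOpen Ω) (hΩb : Bornology.IsBounded Ω)
    (hK : IsMesh Ω Kh) {F : Pt n → Vec} (hF : F ∈ zeroExtSpace Ω Kh)
    (h : wInner Ω 1 F F ≤ 0) : F = 0 := by
  have hfin : IsFiniteMeasure (volume.restrict Ω) := isFiniteMeasure_restrict.2 hΩb.measure_lt_top.ne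
  have hc := continuous_of_mem_zeroExtSpace hΩ hK hF
  have h1 : wInner Ω 1 F F = ∫ x in Ω, inner ℝ (F x) (F x) := by simp [wInner]
  have h2 : (fun x => (inner ℝ (F x) (F x) : ℝ)) =ᵐ[volume.restrict Ω] 0 := by
    rw [← integral_eq_zero_iff_of_nonneg (fun x => real_inner_self_nonneg)
      ((memLp_top_inner hΩ hΩb hK hF hF).integrable le_top)]
    exact le_antisymm (h1 ▸ h) (integral_nonneg fun x => real_inner_self_nonneg)
  have h3 : EqOn (fun x => (inner ℝ (F x) (F x) : ℝ)) 0 Ω :=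
    Measure.eqOn_open_of_ae_eq h2 hΩ (by fun_prop) continuousOn_const
  have h4 : EqOn F 0 (closure Ω) :=
    EqOn.closure (fun x hx => inner_self_eq_zero.1 (h3 hx)) hc continuous_zero
  ext1 x
  by_cases hx : x ∈ closure Ω
  exacts [h4 hx, hF.2 x hx]

/-! ### Locality of the integrals over `Ω` -/

theorem pd_congr (hΩ : IsOpen Ω) {u w : Pt n → ℝ} (h : EqOn u w Ω) {x : Pt n} (hx : x ∈ Ω)
    (i : Fin n) : pd i u x = pd i w x := by
  rw [pd, pd, (h.eventuallyEq_of_mem (hΩ.mem_nhds hx)).fderiv_eq]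

theorem divergence_congr (hn : n ≤ 3) (hΩ : IsOpen Ω) {F G : Pt n → Vec} (h : EqOn F G Ω)
    {x : Pt n} (hx : x ∈ Ω) : divergence hn F x = divergence hn G x :=
  Finset.sum_congr rfl fun i _ => pd_congr hΩ (fun y hy => by simp [h hy]) hx i

theorem gradDot_congr (hΩ : IsOpen Ω) {F F' G G' : Pt n → Vec} (hF : EqOn F F' Ω)
    (hG : EqOn G G' Ω) {x : Pt n} (hx : x ∈ Ω) : gradDot F G x = gradDot F' G' x :=
  Finset.sum_congr rfl fun k _ => Finset.sum_congr rfl fun i _ => congrArg₂ _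
    (pd_congr hΩ (fun y hy => by simp [hF hy]) hx i)
    (pd_congr hΩ (fun y hy => by simp [hG hy]) hx i)

theorem wInner_congr (hΩ : IsOpen Ω) (ω : Pt n → ℝ) {F F' : Pt n → Vec} (hF : EqOn F F' Ω)
    (G : Pt n → Vec) : wInner Ω ω F G = wInner Ω ω F' G :=
  setIntegral_congr_fun hΩ.measurableSet fun x hx => by simp only [hF hx]

theorem wNormSq_congr {V : Type*} [NormedAddCommGroup V] (hΩ : IsOpen Ω) (ω : Pt n → ℝ)
    {u w : Pt n → V} (h : EqOn u w Ω) : wNormSq Ω ω u = wNormSq Ω ω w :=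
  setIntegral_congr_fun hΩ.measurableSet fun x hx => by simp only [h hx]

theorem gradNormSq_congr (hΩ : IsOpen Ω) {F G : Pt n → Vec} (h : EqOn F G Ω) :
    gradNormSq Ω F = gradNormSq Ω G :=
  setIntegral_congr_fun hΩ.measurableSet fun _ hx => gradDot_congr hΩ h h hx

theorem aForm_congr (hn : n ≤ 3) (hΩ : IsOpen Ω) (ε : Pt n → ℝ) {F F' : Pt n → Vec}
    (hF : EqOn F F' Ω) (G : Pt n → Vec) : aForm hn Ω ε F G = aForm hn Ω ε F' G := by
  unfold aForm
  congr 1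
  · exact setIntegral_congr_fun hΩ.measurableSet fun x hx =>
      gradDot_congr hΩ hF (eqOn_refl G Ω) hx
  · refine setIntegral_congr_fun hΩ.measurableSet fun x hx => ?_
    exact congrArg (· * _) (divergence_congr hn hΩ (fun y hy => by simp only [hF hy]) hx)

theorem wNormSq_eq_wInner (ω : Pt n → ℝ) (F : Pt n → Vec) :
    wNormSq Ω ω F = wInner Ω ω F F := by
  simp only [wNormSq, wInner, real_inner_self_eq_norm_sq]

/-! ### Solutions in nodal coordinates -/

variable (Kh) in
/-- The values of a vector field at the vertices of the mesh. -/
def nodalValues (F : Pt n → Vec) : MeshVertex Kh × Fin 3 → ℝ :=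
  fun a => F a.1 a.2

theorem absolutelyContinuousOnInterval_apply {f : ℝ → Vec} {a b : ℝ}
    (hf : AbsolutelyContinuousOnInterval f a b) (k : Fin 3) :
    AbsolutelyContinuousOnInterval (fun t => f t k) a b := by
  refine squeeze_zero (fun _ => Finset.sum_nonneg fun _ _ => dist_nonneg) (fun _ => ?_) hf
  refine Finset.sum_le_sum fun i _ => ?_
  rw [dist_eq_norm, dist_eq_norm]
  exact PiLp.norm_apply_le (f _ - f _) k

theorem hasDerivWithinAt_nodalValues [Fintype (MeshVertex Kh)] {G : ℝ → Pt n → Vec} {T t : ℝ}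
    (h : ∀ v : MeshVertex Kh, DifferentiableWithinAt ℝ (fun s => G s v) (Icc 0 T) t) :
    HasDerivWithinAt (fun s => nodalValues Kh (G s)) (nodalValues Kh (dt T G t)) (Icc 0 T) t := by
  rw [hasDerivWithinAt_pi]
  intro a
  exact (EuclideanSpace.proj (𝕜 := ℝ) a.2 : Vec →L[ℝ] ℝ).hasFDerivAt.comp_hasDerivWithinAt t
    (h a.1).hasDerivWithinAt

/-- If a field is reconstructed from its nodal values at all times, then its time derivative is
reconstructed from the time derivative of the nodal values. -/
theorem dt_eq_reconstruction [Fintype (MeshVertex Kh)] {X : Set (Pt n)}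
    (S : (MeshVertex Kh × Fin 3 → ℝ) →ₗ[ℝ] (Pt n → Vec)) {G : ℝ → Pt n → Vec} {T t : ℝ}
    (hT : 0 < T) (ht : t ∈ Icc 0 T) (hG : ∀ s ∈ Icc 0 T, EqOn (S (nodalValues Kh (G s))) (G s) X)
    {u : MeshVertex Kh × Fin 3 → ℝ}
    (hu : HasDerivWithinAt (fun s => nodalValues Kh (G s)) u (Icc 0 T) t) :
    EqOn (S u) (dt T G t) X := by
  intro x hx
  have h1 : HasDerivWithinAt (fun s => S (nodalValues Kh (G s)) x) (S u x) (Icc 0 T) t :=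
    (LinearMap.toContinuousLinearMap
      ((LinearMap.proj x : (Pt n → Vec) →ₗ[ℝ] Vec) ∘ₗ S)).hasFDerivAt.comp_hasDerivWithinAt t hu
  have h2 : HasDerivWithinAt (fun s => G s x) (S u x) (Icc 0 T) t :=
    h1.congr (fun s hs => (hG s hs hx).symm) (hG t ht hx).symm
  exact (h2.derivWithin (uniqueDiffOn_Icc hT t ht)).symm

section Solution

variable {hn : n ≤ 3} {ε σ : Pt n → ℝ} {T : ℝ}
  {j : ℝ → Pt n → Vec} {f₀ f₁ : Pt n → Vec} {E : ℝ → Pt n → Vec}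
  {S : (MeshVertex Kh × Fin 3 → ℝ) →ₗ[ℝ] (Pt n → Vec)}

theorem IsSemidiscreteSolution.eqOn (hE : IsSemidiscreteSolution hn Ω Kh ε σ T j f₀ f₁ E)
    (hSE : ∀ F, MemWhVec0 Ω Kh F → EqOn (S (nodalValues Kh F)) F (closure Ω)) :
    ∀ t ∈ Icc 0 T, EqOn (S (nodalValues Kh (E t))) (E t) (closure Ω) :=
  fun t ht => hSE _ (hE.mem t ht)

theorem IsSemidiscreteSolution.hasDerivWithinAt [Fintype (MeshVertex Kh)]
    (hE : IsSemidiscreteSolution hn Ω Kh ε σ T j f₀ f₁ E) (hK : IsMesh Ω Kh) {t : ℝ}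
    (ht : t ∈ Icc 0 T) :
    HasDerivWithinAt (fun s => nodalValues Kh (E s)) (nodalValues Kh (dt T E t)) (Icc 0 T) t :=
  hasDerivWithinAt_nodalValues fun v => hE.differentiable v (hK.mem_closure v) t ht

theorem IsSemidiscreteSolution.eqOn_dt [Fintype (MeshVertex Kh)]
    (hE : IsSemidiscreteSolution hn Ω Kh ε σ T j f₀ f₁ E)
    (hK : IsMesh Ω Kh) (hT : 0 < T)
    (hSE : ∀ F, MemWhVec0 Ω Kh F → EqOn (S (nodalValues Kh F)) F (closure Ω)) :
    ∀ t ∈ Icc 0 T, EqOn (S (nodalValues Kh (dt T E t))) (dt T E t) (closure Ω) :=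
  fun _ ht => dt_eq_reconstruction S hT ht (hE.eqOn hSE) (hE.hasDerivWithinAt hK ht)

theorem IsSemidiscreteSolution.absolutelyContinuous_dt
    (hE : IsSemidiscreteSolution hn Ω Kh ε σ T j f₀ f₁ E) (hK : IsMesh Ω Kh)
    (a : MeshVertex Kh × Fin 3) :
    AbsolutelyContinuousOnInterval (fun t => nodalValues Kh (dt T E t) a) 0 T :=
  absolutelyContinuousOnInterval_apply (hE.absolutelyContinuous a.1 (hK.mem_closure a.1)) a.2

theorem IsSemidiscreteSolution.absolutelyContinuous_nodalValues [Fintype (MeshVertex Kh)]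
    (hE : IsSemidiscreteSolution hn Ω Kh ε σ T j f₀ f₁ E) (hK : IsMesh Ω Kh) (hT : 0 < T)
    (a : MeshVertex Kh × Fin 3) :
    AbsolutelyContinuousOnInterval (fun t => nodalValues Kh (E t) a) 0 T := by
  obtain ⟨C, hC⟩ := (hE.absolutelyContinuous_dt hK a).exists_bound
  refine LipschitzOnWith.absolutelyContinuousOnInterval (K := Real.toNNReal C) ?_
  rw [uIcc_of_le hT.le] at hC ⊢
  refine (convex_Icc 0 T).lipschitzOnWith_of_nnnorm_hasDerivWithin_le
    (f' := fun t => nodalValues Kh (dt T E t) a)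
    (fun t ht => hasDerivWithinAt_pi.1 (hE.hasDerivWithinAt hK ht) a) fun t ht => ?_
  rw [← NNReal.coe_le_coe, coe_nnnorm]
  exact (hC t ht).trans (Real.le_coe_toNNReal C)

/-- The semi-discrete problem as a system of ordinary differential equations for the nodal
values. -/
theorem IsSemidiscreteSolution.ae_equation [Fintype (MeshVertex Kh)]
    (hE : IsSemidiscreteSolution hn Ω Kh ε σ T j f₀ f₁ E) (hΩ : IsOpen Ω) (hK : IsMesh Ω Kh)
    (hT : 0 < T) (hS : ∀ p, S p ∈ zeroExtSpace Ω Kh)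
    (hSE : ∀ F, MemWhVec0 Ω Kh F → EqOn (S (nodalValues Kh F)) F (closure Ω)) :
    ∀ᵐ t ∂(volume.restrict (Ioo 0 T)),
      HasDerivAt (fun s => nodalValues Kh (E s)) (nodalValues Kh (dt T E t)) t ∧
      HasDerivAt (fun s => nodalValues Kh (dt T E s)) (nodalValues Kh (dt T (dt T E) t)) t ∧
      ∀ v, wInner Ω ε (S (nodalValues Kh (dt T (dt T E) t))) (S v)
          + wInner Ω σ (S (nodalValues Kh (dt T E t))) (S v)
          + aForm hn Ω ε (S (nodalValues Kh (E t))) (S v)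
        = -∫ x in Ω, inner ℝ (j t x) (S v x) := by
  have hdiff : ∀ᵐ t, ∀ a : MeshVertex Kh × Fin 3, t ∈ uIcc 0 T →
      DifferentiableAt ℝ (fun t => nodalValues Kh (dt T E t) a) t :=
    ae_all_iff.2 fun a => (hE.absolutelyContinuous_dt hK a).ae_differentiableAt
  filter_upwards [hE.equation, ae_restrict_of_ae hdiff, ae_restrict_mem measurableSet_Ioo]
    with t heq hd ht
  have htI : t ∈ Icc 0 T := Ioo_subset_Icc_self ht
  have hnhds : Icc 0 T ∈ nhds t := Icc_mem_nhds ht.1 ht.2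
  have hd2 := hasDerivWithinAt_nodalValues (Kh := Kh) (G := dt T E) (T := T) (t := t) fun v => by
    refine DifferentiableAt.differentiableWithinAt (differentiableAt_euclidean.2 fun k => ?_)
    exact hd (v, k) (by rwa [uIcc_of_le hT.le])
  have h2 := dt_eq_reconstruction S hT htI (hE.eqOn_dt hK hT hSE) hd2
  refine ⟨(hE.hasDerivWithinAt hK htI).hasDerivAt hnhds, hd2.hasDerivAt hnhds, fun v => ?_⟩
  rw [← heq (S v) (hS v).1, wInner_congr hΩ ε (h2.mono subset_closure),
    wInner_congr hΩ σ ((hE.eqOn_dt hK hT hSE t htI).mono subset_closure),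
    aForm_congr hn hΩ ε ((hE.eqOn hSE t htI).mono subset_closure)]

end Solution

/-! ### The right-hand side -/

theorem integrableOn_integral_norm_sq {T : ℝ} {j : ℝ → Pt n → Vec}
    (hj : MemLp (fun p : ℝ × Pt n => j p.1 p.2) 2 (volume.restrict (Ioo 0 T ×ˢ Ω))) :
    IntegrableOn (fun t => ∫ x in Ω, ‖j t x‖ ^ 2) (Ioo 0 T) := by
  have h := hj.integrable_norm_pow (by norm_num)
  rw [Measure.volume_eq_prod, ← Measure.prod_restrict] at h
  exact h.integral_prod_left

theorem spaceTimeNormSq_eq {T t : ℝ} (htT : t ≤ T) {j : ℝ → Pt n → Vec}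
    (hj : MemLp (fun p : ℝ × Pt n => j p.1 p.2) 2 (volume.restrict (Ioo 0 T ×ˢ Ω))) :
    spaceTimeNormSq Ω t j = ∫ s in Ioo 0 t, ∫ x in Ω, ‖j s x‖ ^ 2 := by
  have h : IntegrableOn (fun p : ℝ × Pt n => ‖j p.1 p.2‖ ^ 2) (Ioo 0 t ×ˢ Ω) :=
    IntegrableOn.mono_set (hj.integrable_norm_pow (by norm_num))
      (prod_mono (Ioo_subset_Ioo_right htT) subset_rfl)
  rw [Measure.volume_eq_prod] at h
  rw [spaceTimeNormSq, Measure.volume_eq_prod, setIntegral_prod _ h]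

theorem ae_two_mul_abs_integral_inner_le {T : ℝ} (hΩ : IsOpen Ω) (hΩb : Bornology.IsBounded Ω)
    (hK : IsMesh Ω Kh) {j : ℝ → Pt n → Vec}
    (hj : MemLp (fun p : ℝ × Pt n => j p.1 p.2) 2 (volume.restrict (Ioo 0 T ×ˢ Ω))) :
    ∀ᵐ t ∂(volume.restrict (Ioo 0 T)), ∀ F ∈ zeroExtSpace Ω Kh,
      2 * |∫ x in Ω, inner ℝ (j t x) (F x)| ≤ (∫ x in Ω, ‖j t x‖ ^ 2) + wInner Ω 1 F F := by
  have hfin : IsFiniteMeasure (volume.restrict Ω) := isFiniteMeasure_restrict.2 hΩb.measure_lt_top.ne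
  have h1 := hj.integrable_norm_pow (by norm_num)
  rw [Measure.volume_eq_prod, ← Measure.prod_restrict] at h1
  filter_upwards [h1.prod_right_ae] with t ht F hF
  have hF2 := (memLp_top_inner hΩ hΩb hK hF hF).integrable le_top
  calc 2 * |∫ x in Ω, inner ℝ (j t x) (F x)|
      ≤ 2 * ∫ x in Ω, (‖j t x‖ ^ 2 + inner ℝ (F x) (F x)) / 2 := by
        gcongr
        rw [← Real.norm_eq_abs]
        refine norm_integral_le_of_norm_le ((ht.add hF2).div_const 2) (.of_forall fun x => ?_)
        rw [real_inner_self_eq_norm_sq]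
        have := norm_inner_le_norm (𝕜 := ℝ) (j t x) (F x)
        nlinarith [sq_nonneg (‖j t x‖ - ‖F x‖)]
    _ = (∫ x in Ω, ‖j t x‖ ^ 2) + wInner Ω 1 F F := by
        rw [integral_div, integral_add ht hF2]
        simp only [wInner, Pi.one_apply, one_mul]
        ring

/-! ### Uniqueness and stability -/

section Main

variable {hn : n ≤ 3} {ε σ : Pt n → ℝ} {A S' T : ℝ} {j : ℝ → Pt n → Vec}
  {f₀ f₁ : Pt n → Vec} {E E' : ℝ → Pt n → Vec}

/-- The semi-discrete problem has at most one solution: the difference of two solutions satisfies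
the homogeneous system with zero initial values, so its energy vanishes. -/
theorem IsSemidiscreteSolution.unique (hE : IsSemidiscreteSolution hn Ω Kh ε σ T j f₀ f₁ E)
    (hE' : IsSemidiscreteSolution hn Ω Kh ε σ T j f₀ f₁ E') (hΩ : IsOpen Ω)
    (hΩb : Bornology.IsBounded Ω) (hK : IsMesh Ω Kh) (hc : CoeffBounds Ω ε σ A S') (hT : 0 < T)
    {t : ℝ} (ht : t ∈ Icc 0 T) {x : Pt n} (hx : x ∈ closure Ω) : E' t x = E t x := by
  have := hK.finite_meshVertex
  have := Fintype.ofFinite (MeshVertex Kh)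
  obtain ⟨S, hS, hSE⟩ := exists_reconstruction hΩ hK
  obtain ⟨M, Mσ, K, D, B, N, hform, hM, hMσ, ha, -, -, hN, -⟩ :=
    exists_energyForms hn hΩ hΩb hK hc hS
  have h0I : (0 : ℝ) ∈ Icc 0 T := left_mem_Icc.2 hT.le
  -- The nodal values of the data coincide, because members of the finite element space that agree
  -- on `Ω` agree on its closure.
  have hnodal {F G : Pt n → Vec} (hF : EqOn (S (nodalValues Kh F)) F (closure Ω))
      (hG : EqOn (S (nodalValues Kh G)) G (closure Ω)) (h : EqOn F G Ω) :
      nodalValues Kh F = nodalValues Kh G := by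
    have h1 : EqOn (S (nodalValues Kh F)) (S (nodalValues Kh G)) (closure Ω) := by
      refine EqOn.closure (fun y hy => ?_) (continuous_of_mem_zeroExtSpace hΩ hK (hS _))
        (continuous_of_mem_zeroExtSpace hΩ hK (hS _))
      rw [hF (subset_closure hy), hG (subset_closure hy), h hy]
    ext a
    have ha := hK.mem_closure a.1
    simp only [nodalValues]
    rw [← hF ha, ← hG ha, h1 ha]
  have hp0 : nodalValues Kh (E' 0) = nodalValues Kh (E 0) :=
    hnodal (hE'.eqOn hSE 0 h0I) (hE.eqOn hSE 0 h0I)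
      fun y hy => (hE'.initial y hy).trans (hE.initial y hy).symm
  have hq0 : nodalValues Kh (dt T E' 0) = nodalValues Kh (dt T E 0) :=
    hnodal (hE'.eqOn_dt hK hT hSE 0 h0I) (hE.eqOn_dt hK hT hSE 0 h0I)
      fun y hy => (hE'.initial_dt y hy).trans (hE.initial_dt y hy).symm
  have hest := hform.modifiedEnergy_le_exp
    (p := fun t => nodalValues Kh (E' t) - nodalValues Kh (E t))
    (q := fun t => nodalValues Kh (dt T E' t) - nodalValues Kh (dt T E t))
    (r := fun t => nodalValues Kh (dt T (dt T E') t) - nodalValues Kh (dt T (dt T E) t))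
    (ℓ := fun _ _ => 0) (g := fun _ => 0)
    (fun a => (hE'.absolutelyContinuous_nodalValues hK hT a).fun_sub
      (hE.absolutelyContinuous_nodalValues hK hT a))
    (fun a => (hE'.absolutelyContinuous_dt hK a).fun_sub (hE.absolutelyContinuous_dt hK a))
    integrableOn_zero (fun _ => le_rfl) (by
      filter_upwards [hE'.ae_equation hΩ hK hT hS hSE, hE.ae_equation hΩ hK hT hS hSE]
        with s ⟨h1, h2, h3⟩ ⟨k1, k2, k3⟩
      refine ⟨h1.fun_sub k1, h2.fun_sub k2, fun v => ?_⟩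
      have h3 := h3 v
      have k3 := k3 v
      rw [← hM, ← hMσ, ← ha] at h3 k3
      simp only [map_sub, LinearMap.sub_apply]
      linarith)
    (.of_forall fun s v => by simpa using hform.N_nonneg v) ht
  simp only [hp0, hq0, sub_self, integral_zero, add_zero] at hest
  have hzero : modifiedEnergy M K D B N (18 * A ^ 2) 0 0 = 0 := by simp [modifiedEnergy]
  rw [hzero, mul_zero] at hest
  set d := nodalValues Kh (E' t) - nodalValues Kh (E t) with hd
  have hle := (hform.le_modifiedEnergy d _).trans hest
  have hNd : wInner Ω 1 (S d) (S d) ≤ 0 := by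
    rw [← hN]
    have h1 := hform.K_nonneg d
    have h2 := hform.D_nonneg d
    have h3 := (hform.N_nonneg _).trans
      (hform.N_le_M (nodalValues Kh (dt T E' t) - nodalValues Kh (dt T E t)))
    linarith
  have hSd := congrFun (eq_zero_of_wInner_one hΩ hΩb hK (hS d) hNd) x
  rw [hd, map_sub, Pi.sub_apply, hE'.eqOn hSE t ht hx, hE.eqOn hSE t ht hx, Pi.zero_apply,
    sub_eq_zero] at hSd
  exact hSd

/-- The energy estimate with an explicit constant, where `Ω` lies in the ball of radius `R` about
the origin. -/
theorem IsSemidiscreteSolution.energy_le (hE : IsSemidiscreteSolution hn Ω Kh ε σ T j f₀ f₁ E)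
    (hn₂ : 2 ≤ n) (hΩ : IsOpen Ω) (hΩb : Bornology.IsBounded Ω) {R : ℝ} (hR : ∀ x ∈ Ω, ‖x‖ ≤ R)
    (hK : IsMesh Ω Kh) (hc : CoeffBounds Ω ε σ A S') (hS' : 0 ≤ S') (hT : 0 < T)
    (hj : MemLp (fun p : ℝ × Pt n => j p.1 p.2) 2 (volume.restrict (Ioo 0 T ×ˢ Ω)))
    {t : ℝ} (ht : t ∈ Icc 0 T) :
    energy hn Ω ε σ T E t ≤
      (2 + S') * (Real.exp ((2 * (18 * A ^ 2) + 2) * t) *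
        (3 / 2 + (2 * (18 * A ^ 2) + 1) * (4 * R ^ 2))) *
      (spaceTimeNormSq Ω t j + wNormSq Ω ε f₁ + gradNormSq Ω f₀ + wNormSq Ω σ f₀
        + wNormSq Ω (fun x => ε x - 1) (divergence hn f₀)) := by
  have := hK.finite_meshVertex
  have := Fintype.ofFinite (MeshVertex Kh)
  obtain ⟨S, hS, hSE⟩ := exists_reconstruction hΩ hK
  obtain ⟨M, Mσ, K, D, B, N, hform, hM, hMσ, ha, hKe, hDe, hN, hσ⟩ :=
    exists_energyForms hn hΩ hΩb hK hc hS
  have h0I : (0 : ℝ) ∈ Icc 0 T := left_mem_Icc.2 hT.le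
  have hg : ∀ t, 0 ≤ ∫ x in Ω, ‖j t x‖ ^ 2 := fun t => integral_nonneg fun x => sq_nonneg _
  have hest := hform.modifiedEnergy_le_exp (ℓ := fun t v => ∫ x in Ω, inner ℝ (j t x) (S v x))
    (hE.absolutelyContinuous_nodalValues hK hT) (hE.absolutelyContinuous_dt hK)
    (integrableOn_integral_norm_sq hj) hg (by
      filter_upwards [hE.ae_equation hΩ hK hT hS hSE] with s ⟨h1, h2, h3⟩
      refine ⟨h1, h2, fun v => ?_⟩
      rw [hM, hMσ, ha]
      exact h3 v)
    (by
      filter_upwards [ae_two_mul_abs_integral_inner_le hΩ hΩb hK hj] with s hs v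
      rw [hN]
      exact hs _ (hS v)) ht
  rw [← spaceTimeNormSq_eq ht.2 hj] at hest
  have hj0 : 0 ≤ spaceTimeNormSq Ω t j := integral_nonneg fun _ => sq_nonneg _
  set J := spaceTimeNormSq Ω t j
  have hEt := (hE.eqOn hSE t ht).mono (subset_closure (s := Ω))
  have hEt' := (hE.eqOn_dt hK hT hSE t ht).mono (subset_closure (s := Ω))
  have hE0 : EqOn (S (nodalValues Kh (E 0))) f₀ Ω := fun x hx =>
    (hE.eqOn hSE 0 h0I (subset_closure hx)).trans (hE.initial x hx)
  have hE0' : EqOn (S (nodalValues Kh (dt T E 0))) f₁ Ω := fun x hx =>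
    (hE.eqOn_dt hK hT hSE 0 h0I (subset_closure hx)).trans (hE.initial_dt x hx)
  have hdiv {F G : Pt n → Vec} (h : EqOn F G Ω) : EqOn (divergence hn F) (divergence hn G) Ω :=
    fun x hx => divergence_congr hn hΩ h hx
  rw [energy, ← wNormSq_congr hΩ ε hEt', ← wNormSq_congr hΩ σ hEt, ← gradNormSq_congr hΩ hEt,
    ← wNormSq_congr hΩ _ (hdiv hEt), ← wNormSq_congr hΩ ε hE0', ← wNormSq_congr hΩ σ hE0,
    ← gradNormSq_congr hΩ hE0, ← wNormSq_congr hΩ _ (hdiv hE0)]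
  simp only [wNormSq_eq_wInner, ← hM, ← hMσ, ← hKe, ← hDe]
  set p := nodalValues Kh (E t)
  set q := nodalValues Kh (dt T E t)
  set p₀ := nodalValues Kh (E 0)
  set q₀ := nodalValues Kh (dt T E 0)
  set b := 18 * A ^ 2
  have hb : 0 ≤ b := hform.b_nonneg
  set c := 3 / 2 + (2 * b + 1) * (4 * R ^ 2) with hcdef
  have hcr : 0 ≤ (2 * b + 1) * (4 * R ^ 2) := by positivity
  have hpoin : N p₀ p₀ ≤ 4 * R ^ 2 * K p₀ p₀ := by
    rw [hN, hKe]
    exact wInner_one_le hn₂ hΩ hΩb hK hR (hS p₀)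
  have hM0 : 0 ≤ M q₀ q₀ := (hform.N_nonneg q₀).trans (hform.N_le_M q₀)
  have hMt : 0 ≤ M q q := (hform.N_nonneg q).trans (hform.N_le_M q)
  set Y := modifiedEnergy M K D B N b p q
  set data := J + M q₀ q₀ + K p₀ p₀ + Mσ p₀ p₀ + D p₀ p₀ with hdata
  have hinit : modifiedEnergy M K D B N b p₀ q₀ + J ≤ c * data := by
    have h1 := hform.modifiedEnergy_le p₀ q₀
    have h2 := mul_le_mul_of_nonneg_left hpoin (by linarith : 0 ≤ 2 * b + 1)
    have h3 := hform.K_nonneg p₀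
    have h4 := hform.D_nonneg p₀
    have h5 := hform.Mσ_nonneg p₀
    have h6 : 0 ≤ (2 * b + 1) * (4 * R ^ 2) * (J + M q₀ q₀ + Mσ p₀ p₀ + D p₀ p₀) := by positivity
    rw [hcdef, hdata]
    linarith
  have hfinal : M q q + Mσ p p + K p p + D p p ≤ (2 + S') * Y := by
    have h1 := hform.le_modifiedEnergy p q
    have h2 := hform.K_nonneg p
    have h3 := hform.D_nonneg p
    have h4 := hform.N_nonneg p
    have h5 := hσ p
    have h6 := mul_le_mul_of_nonneg_left (by linarith : N p p ≤ Y) hS'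
    linarith
  calc M q q + Mσ p p + K p p + D p p ≤ (2 + S') * Y := hfinal
    _ ≤ (2 + S') * (Real.exp ((2 * b + 2) * t) * (c * data)) := by
        gcongr
        exact hest.trans (mul_le_mul_of_nonneg_left hinit (Real.exp_nonneg _))
    _ = (2 + S') * (Real.exp ((2 * b + 2) * t) * c) * data := by ring

end Main

end StabMaxwell

end

theorem mainTheorem3 {n : ℕ} (hn₂ : 2 ≤ n) (hn₃ : n ≤ 3)
    (Ω : Set (StabMaxwell.Pt n)) (hΩ : IsOpen Ω) (hΩb : Bornology.IsBounded Ω)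
    (A S : ℝ≥0) (tstar : ℝ) (ht : 0 < tstar) :
    ∃ C : ℝ, 0 < C ∧
      ∀ (Ωin Ωout Ω₂ : Set (StabMaxwell.Pt n)) (d₁ d₂ : ℝ) (ε σ : StabMaxwell.Pt n → ℝ)
        (Kh : Geometry.SimplicialComplex ℝ (StabMaxwell.Pt n)) (T : ℝ)
        (j : ℝ → StabMaxwell.Pt n → StabMaxwell.Vec)
        (f₀h f₁h : StabMaxwell.Pt n → StabMaxwell.Vec)
        (Eh : ℝ → StabMaxwell.Pt n → StabMaxwell.Vec),
        StabMaxwell.CoeffCondition Ω Ωin Ωout Ω₂ d₁ d₂ ε σ →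
        StabMaxwell.c2Norm Ω ε ≤ (A : ℝ≥0∞) →
        StabMaxwell.supNorm Ω σ ≤ (S : ℝ≥0∞) →
        StabMaxwell.IsMesh Ω Kh →
        tstar < T →
        MemLp (fun p : ℝ × StabMaxwell.Pt n => j p.1 p.2) 2
          (volume.restrict (Ioo 0 T ×ˢ Ω)) →
        StabMaxwell.MemWhVec Ω Kh f₀h →
        StabMaxwell.MemWhVec Ω Kh f₁h →
        StabMaxwell.IsSemidiscreteSolution hn₃ Ω Kh ε σ T j f₀h f₁h Eh →
        (∀ Eh' : ℝ → StabMaxwell.Pt n → StabMaxwell.Vec,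
          StabMaxwell.IsSemidiscreteSolution hn₃ Ω Kh ε σ T j f₀h f₁h Eh' →
          ∀ t ∈ Icc 0 T, ∀ x ∈ closure Ω, Eh' t x = Eh t x) ∧
        StabMaxwell.energy hn₃ Ω ε σ T Eh tstar ≤
          C * (StabMaxwell.spaceTimeNormSq Ω tstar j
            + StabMaxwell.wNormSq Ω ε f₁h
            + StabMaxwell.gradNormSq Ω f₀h
            + StabMaxwell.wNormSq Ω σ f₀h
            + StabMaxwell.wNormSq Ω (fun x => ε x - 1)
                (StabMaxwell.divergence hn₃ f₀h)) := by
  obtain ⟨R, hR⟩ := hΩb.exists_norm_le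
  refine ⟨(2 + S) * (Real.exp ((2 * (18 * (A : ℝ) ^ 2) + 2) * tstar) *
    (3 / 2 + (2 * (18 * (A : ℝ) ^ 2) + 1) * (4 * R ^ 2))), by positivity, ?_⟩
  intro Ωin Ωout Ω₂ d₁ d₂ ε σ Kh T j f₀h f₁h Eh hcoeff hA hS hK htT hj _ _ hE
  have hT : 0 < T := ht.trans htT
  have hc := hcoeff.coeffBounds hΩ hA hS
  exact ⟨fun Eh' hE' t htI x hx => hE.unique hE' hΩ hΩb hK hc hT htI hx,
    hE.energy_le hn₂ hΩ hΩb hR hK hc S.2 hT hj ⟨ht.le, htT.le⟩⟩
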